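/- Let $k$ be a commutative ring with unit and let $A$ be a (unital, associative) $k$-algebra, with enveloping algebra $A^e = A\otimes_k A^{op}$; an $A^e$-module is the same as an $A$-bimodule on which $k$ acts centrally. Let $\sigma$ be a $k$-algebra automorphism of $A$, let $\delta\colon A\to A$ be a $\sigma$-derivation (a $k$-linear map with $\delta(ab)=\delta(a)b+\sigma(a)\delta(b)$), and let $E=A[x;\sigma,\delta]$ be the Ore extension: the $k$-algebra containing $A$ as a subalgebra, free as a left $A$-module with basis $1,x,x^2,\dots$, with $xa=\sigma(a)x+\delta(a)$ for all $a\in A$. For an $A$-bimodule $M$ let $H^n(A,M)$ be Hochschild cohomology, that is, the cohomology of the complex $C^n(A,M)=\mathrm{Hom}_k(A^{\otimes n},M)$ with differential $$(bf)(a_1,\dots,a_{n+1})=a_1f(a_2,\dots,a_{n+1})+\sum_{i=1}^n(-1)^if(a_1,\dots,a_ia_{i+1},\dots,a_{n+1})+(-1)^{n+1}f(a_1,\dots,a_n)a_{n+1}.$$ On $E\otimes E=E\otimes_kE$ consider the outer $E$-bimodule structure $a\cdot(m\otimes n)\cdot b=am\otimes nb$ and the inner one $a\cdot(m\otimes n)\cdot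 b=mb\otimes an$. In $H^n(E,E\otimes E)$ and $H^n(A,E\otimes E)$ the coefficients carry the outer structure (restricted to $A$ in the second case), and $H^n(A,E\otimes E^{\sigma^{-1}})$ is formed with the $A$-bimodule structure $a\cdot(m\otimes n)\cdot b=am\otimes n\sigma^{-1}(b)$ on $E\otimes E$. All three are $E^e$-modules through the inner structure on $E\otimes E$. Suppose that $A$ is projective as a $k$-module and that $A$ has a resolution by finitely generated projective $A^e$-modules (possibly of infinite length). Then for every integer $n\ge 0$ there is a short exact sequence of $E^e$-modules $$0\longrightarrow H^n(A,E\otimes E)\overset{\partial}{\longrightarrow}H^n(A,E\otimes E^{\sigma^{-1}})\longrightarrow H^{n+1}(E,E\otimes E)\longrightarrow 0,$$ where $\partial=H^n(\theta)$ is induced by the cochain map $\theta\colon C^*(A,E\otimes E)\to C^*(A,E\otimes E^{\sigma^{-1}})$ given, with the outer actions of $x$, by $$\theta^n(f)(a_1,\dots,a_n)=x\,f(\sigma^{-1}(a_1),\dots,\sigma^{-1}(a_n))-f(a_1,\dots,a_n)\,x-\sum_{j=1}^nf(a_1,\dots,a_{j-1},\delta\sigma^{-1}(a_j),\sigma^{-1}(a_{j+1}),\dots,\sigma^{-1}(a_n)).$$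 -/

import Mathlib

open scoped TensorProduct

universe u v w z

namespace OreHochschild

section Bimodules

/-- The enveloping algebra `Aᵉ = A ⊗ Aᵒᵖ`. -/
abbrev Env (k : Type u) (A : Type v) [CommRing k] [Ring A] [Algebra k A] : Type v :=
  A ⊗[k] Aᵐᵒᵖ

/-- An `A`-bimodule structure (that is, an `Aᵉ`-module structure) on `M` which commutes with the
action of a further ring `R` on `M`: the element `c (a ⊗ₜ op b)` is the map `m ↦ a · m · b`. -/
abbrev BimoduleStr (k : Type u) (A : Type v) (R : Type w) (M : Type z)
    [CommRing k] [Ring A] [Algebra k A] [Ring R] [Algebra k R]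
    [AddCommGroup M] [Module k M] [Module R M] [IsScalarTower k R M] : Type (max v z) :=
  Env k A →ₐ[k] Module.End R M

variable {k : Type u} {A : Type v} {B : Type v} {R : Type w} {M : Type z}
  [CommRing k] [Ring A] [Algebra k A] [Ring B] [Algebra k B] [Ring R] [Algebra k R]
  [AddCommGroup M] [Module k M] [Module R M] [IsScalarTower k R M]

namespace BimoduleStr

/-- The map `m ↦ a · m`. -/
def lact (c : BimoduleStr k A R M) (a : A) : Module.End R M :=
  c (a ⊗ₜ[k] 1)

/-- The map `m ↦ m · b`. -/
def ract (c : BimoduleStr k A R M) (b : A) : Module.End R M :=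
  c (1 ⊗ₜ[k] MulOpposite.op b)

/-- A `B`-bimodule regarded as an `A`-bimodule along an algebra homomorphism `ι : A → B`. -/
def restrict (ι : A →ₐ[k] B) (c : BimoduleStr k B R M) : BimoduleStr k A R M :=
  c.comp (Algebra.TensorProduct.map ι (AlgHom.op ι))

/-- The twisted bimodule `M^ν`, with `a · m · b` replaced by `a · m · ν(b)`. -/
def twistRight (ν : A →ₐ[k] A) (c : BimoduleStr k A R M) : BimoduleStr k A R M :=
  c.comp (Algebra.TensorProduct.map (AlgHom.id k A) (AlgHom.op ν))

end BimoduleStr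

end Bimodules

section TensorSquare

/-- `E ⊗ E`, carrying the inner `Eᵉ`-module structure `a · (m ⊗ n) · b = m b ⊗ a n`
as its `Module (Env k E)` instance. -/
def TensorSquare (k : Type u) (E : Type v) [CommRing k] [Ring E] [Algebra k E] : Type v :=
  E ⊗[k] E

variable (k : Type u) (E : Type v) [CommRing k] [Ring E] [Algebra k E]

noncomputable instance : AddCommGroup (TensorSquare k E) :=
  inferInstanceAs (AddCommGroup (E ⊗[k] E))

noncomputable instance : Module k (TensorSquare k E) :=
  inferInstanceAs (Module k (E ⊗[k] E))

/-- The inner action `(a ⊗ op b) : m ⊗ n ↦ m b ⊗ a n`. -/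
noncomputable def innerAction : Env k E →ₐ[k] Module.End k (E ⊗[k] E) :=
  Algebra.TensorProduct.lift
    (AlgHom.ofLinearMap
      (LinearMap.lTensorHom (R := k) E ∘ₗ (LinearMap.mul k E))
      (by ext; simp) (by intro a b; ext; simp [mul_assoc]))
    (AlgHom.ofLinearMap
      (LinearMap.rTensorHom (R := k) E ∘ₗ (LinearMap.mul k E).flip ∘ₗ
        (MulOpposite.opLinearEquiv k).symm.toLinearMap)
      (by ext; simp) (by intro a b; ext; simp [mul_assoc]))
    (by intro a b; ext; simp)

/-- The outer action `(a ⊗ op b) : m ⊗ n ↦ a m ⊗ n b`. -/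
noncomputable def outerAction : Env k E →ₐ[k] Module.End k (E ⊗[k] E) :=
  Algebra.TensorProduct.lift
    (AlgHom.ofLinearMap
      (LinearMap.rTensorHom (R := k) E ∘ₗ (LinearMap.mul k E))
      (by ext; simp) (by intro a b; ext; simp [mul_assoc]))
    (AlgHom.ofLinearMap
      (LinearMap.lTensorHom (R := k) E ∘ₗ (LinearMap.mul k E).flip ∘ₗ
        (MulOpposite.opLinearEquiv k).symm.toLinearMap)
      (by ext; simp) (by intro a b; ext; simp [mul_assoc]))
    (by intro a b; ext; simp)

variable {k E} in
theorem innerAction_tmul (a : E) (b : Eᵐᵒᵖ) (m n : E) :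
    innerAction k E (a ⊗ₜ[k] b) (m ⊗ₜ[k] n) = (m * b.unop) ⊗ₜ[k] (a * n) := by
  rfl

variable {k E} in
theorem outerAction_tmul (a : E) (b : Eᵐᵒᵖ) (m n : E) :
    outerAction k E (a ⊗ₜ[k] b) (m ⊗ₜ[k] n) = (a * m) ⊗ₜ[k] (n * b.unop) := by
  rfl

variable {k E} in
theorem outer_inner_comm (e e' : Env k E) (t : E ⊗[k] E) :
    outerAction k E e (innerAction k E e' t) = innerAction k E e' (outerAction k E e t) := by
  induction e using TensorProduct.induction_on with
  | zero => simp
  | add e₁ e₂ h₁ h₂ => simp only [map_add, LinearMap.add_apply, h₁, h₂]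
  | tmul a b =>
    induction e' using TensorProduct.induction_on with
    | zero => simp
    | add e₁ e₂ h₁ h₂ => simp only [map_add, LinearMap.add_apply, h₁, h₂]
    | tmul a' b' =>
      induction t using TensorProduct.induction_on with
      | zero => simp
      | add t₁ t₂ h₁ h₂ => simp only [map_add, h₁, h₂]
      | tmul m n => simp only [innerAction_tmul, outerAction_tmul, mul_assoc]

noncomputable instance : Module (Env k E) (TensorSquare k E) :=
  Module.compHom (E ⊗[k] E) (innerAction k E).toRingHom

instance : IsScalarTower k (Env k E) (TensorSquare k E) where
  smul_assoc r e t := DFunLike.congr_fun (map_smul (innerAction k E) r e) t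

/-- The outer `E`-bimodule structure `a · (m ⊗ n) · b = a m ⊗ n b` on `E ⊗ E`, which commutes
with the inner one. -/
noncomputable def outerStr : BimoduleStr k E (Env k E) (TensorSquare k E) where
  toFun e :=
    { toFun := outerAction k E e
      map_add' := map_add (outerAction k E e)
      map_smul' := fun e' t => outer_inner_comm e e' t }
  map_one' := LinearMap.ext fun t => DFunLike.congr_fun (map_one (outerAction k E)) t
  map_mul' e e' := LinearMap.ext fun t => DFunLike.congr_fun (map_mul (outerAction k E) e e') t
  map_zero' := LinearMap.ext fun t => DFunLike.congr_fun (map_zero (outerAction k E)) t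
  map_add' e e' := LinearMap.ext fun t => DFunLike.congr_fun (map_add (outerAction k E) e e') t
  commutes' r := LinearMap.ext fun t => by
    refine (DFunLike.congr_fun ((outerAction k E).commutes r) t).trans ?_
    rfl

end TensorSquare

section Hochschild

variable {k : Type u} {A : Type v} {R : Type w} {M : Type z}
  [CommRing k] [Ring A] [Algebra k A] [Ring R] [Algebra k R]
  [AddCommGroup M] [Module k M] [Module R M] [IsScalarTower k R M]

variable (k A M) in
/-- Hochschild cochains `Cⁿ(A, M) = Hom_k(A^{⊗ n}, M)`, as `k`-multilinear maps `Aⁿ → M`. -/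
abbrev Cochain (n : ℕ) : Type (max v z) :=
  MultilinearMap k (fun _ : Fin n => A) M

theorem contractNth_update {n : ℕ} (j : Fin n) [DecidableEq (Fin (n + 1))]
    (a : Fin (n + 1) → A) (i : Fin (n + 1)) :
    ∃ (p : Fin n) (L : A →ₗ[k] A), ∀ x,
      Fin.contractNth j.castSucc (· * ·) (Function.update a i x) =
        Function.update (Fin.contractNth j.castSucc (· * ·) a) p (L x) := by
  rcases lt_trichotomy i.val j.val with h | h | h
  · refine ⟨⟨i.val, by omega⟩, LinearMap.id, fun x => ?_⟩
    ext q
    simp only [Fin.contractNth, Function.update_apply, Fin.ext_iff, Fin.val_castSucc, Fin.val_succ,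
      LinearMap.id_apply]
    split_ifs <;> first | rfl | omega
  · refine ⟨j, LinearMap.mulRight k (a j.succ), fun x => ?_⟩
    ext q
    simp only [Fin.contractNth, Function.update_apply, Fin.ext_iff, Fin.val_castSucc, Fin.val_succ,
      LinearMap.mulRight_apply]
    split_ifs with h1 h2 h3 <;> first | rfl | omega | skip
    obtain rfl : q = j := by ext; assumption
    rfl
  · by_cases h' : i.val = j.val + 1
    · refine ⟨j, LinearMap.mulLeft k (a j.castSucc), fun x => ?_⟩
      ext q
      simp only [Fin.contractNth, Function.update_apply, Fin.ext_iff, Fin.val_castSucc,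
        Fin.val_succ, LinearMap.mulLeft_apply]
      split_ifs with h1 h2 h3 <;> first | rfl | omega | skip
      obtain rfl : q = j := by ext; assumption
      rfl
    · refine ⟨⟨i.val - 1, by omega⟩, LinearMap.id, fun x => ?_⟩
      ext q
      simp only [Fin.contractNth, Function.update_apply, Fin.ext_iff, Fin.val_castSucc,
        Fin.val_succ, LinearMap.id_apply]
      split_ifs <;> first | rfl | omega

/-- The cochain `(a₀, …, aₙ) ↦ f (a₀, …, aⱼ aⱼ₊₁, …, aₙ)`. -/
def contract {n : ℕ} (j : Fin n) (f : Cochain k A M n) : Cochain k A M (n + 1) where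
  toFun a := f (Fin.contractNth j.castSucc (· * ·) a)
  map_update_add' a i x y := by
    obtain ⟨p, L, hL⟩ := contractNth_update (k := k) j a i
    simp [hL]
  map_update_smul' a i r x := by
    obtain ⟨p, L, hL⟩ := contractNth_update (k := k) j a i
    simp [hL]

theorem lact_add (c : BimoduleStr k A R M) (a b : A) : c.lact (a + b) = c.lact a + c.lact b := by
  simp [BimoduleStr.lact, TensorProduct.add_tmul]

theorem lact_smul (c : BimoduleStr k A R M) (r : k) (a : A) : c.lact (r • a) = r • c.lact a := by
  simp [BimoduleStr.lact, ← TensorProduct.smul_tmul']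

theorem ract_add (c : BimoduleStr k A R M) (a b : A) : c.ract (a + b) = c.ract a + c.ract b := by
  simp [BimoduleStr.ract, TensorProduct.tmul_add]

theorem ract_smul (c : BimoduleStr k A R M) (r : k) (a : A) : c.ract (r • a) = r • c.ract a := by
  simp [BimoduleStr.ract]

/-- The cochain `(a₀, …, aₙ) ↦ a₀ · f (a₁, …, aₙ)`. -/
def firstFace {n : ℕ} (c : BimoduleStr k A R M) (f : Cochain k A M n) :
    Cochain k A M (n + 1) where
  toFun a := c.lact (a 0) (f fun i => a i.succ)
  map_update_add' a i x y := by
    cases i using Fin.cases with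
    | zero => simp [Function.update_of_ne, lact_add]
    | succ i =>
      have h : ∀ z, (fun l : Fin n => Function.update a i.succ z l.succ) =
          Function.update (fun l : Fin n => a l.succ) i z := fun z => by
        ext l; simp [Function.update_apply, Fin.ext_iff]
      simp [h, Function.update_of_ne (Fin.succ_ne_zero i).symm]
  map_update_smul' a i r x := by
    cases i using Fin.cases with
    | zero => simp [Function.update_of_ne, lact_smul]
    | succ i =>
      have h : ∀ z, (fun l : Fin n => Function.update a i.succ z l.succ) =
          Function.update (fun l : Fin n => a l.succ) i z := fun z => by
        ext l; simp [Function.update_apply, Fin.ext_iff]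
      simp [h, Function.update_of_ne (Fin.succ_ne_zero i).symm, LinearMap.map_smul_of_tower]

/-- The cochain `(a₀, …, aₙ) ↦ f (a₀, …, aₙ₋₁) · aₙ`. -/
def lastFace {n : ℕ} (c : BimoduleStr k A R M) (f : Cochain k A M n) :
    Cochain k A M (n + 1) where
  toFun a := c.ract (a (Fin.last n)) (f fun i => a i.castSucc)
  map_update_add' a i x y := by
    cases i using Fin.lastCases with
    | last => simp [Function.update_of_ne, Fin.castSucc_ne_last, ract_add]
    | cast i =>
      have h : ∀ z, (fun l : Fin n => Function.update a i.castSucc z l.castSucc) =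
          Function.update (fun l : Fin n => a l.castSucc) i z := fun z => by
        ext l; simp [Function.update_apply, Fin.ext_iff]
      simp [h, Function.update_of_ne (Fin.castSucc_ne_last i).symm]
  map_update_smul' a i r x := by
    cases i using Fin.lastCases with
    | last => simp [Function.update_of_ne, Fin.castSucc_ne_last, ract_smul]
    | cast i =>
      have h : ∀ z, (fun l : Fin n => Function.update a i.castSucc z l.castSucc) =
          Function.update (fun l : Fin n => a l.castSucc) i z := fun z => by
        ext l; simp [Function.update_apply, Fin.ext_iff]
      simp [h, Function.update_of_ne (Fin.castSucc_ne_last i).symm, LinearMap.map_smul_of_tower]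

/-- The Hochschild differential `Cⁿ(A, M) → Cⁿ⁺¹(A, M)`. -/
def hochD (c : BimoduleStr k A R M) (n : ℕ) : Cochain k A M n →ₗ[R] Cochain k A M (n + 1) where
  toFun f := firstFace c f + ∑ j : Fin n, (-1 : ℤ) ^ (j.val + 1) • contract j f +
    (-1 : ℤ) ^ (n + 1) • lastFace c f
  map_add' f g := by
    ext a
    simp only [add_apply, sum_apply, smul_apply,
      firstFace, lastFace, contract, MultilinearMap.coe_mk, map_add, smul_add,
      Finset.sum_add_distrib]
    abel
  map_smul' r f := by
    ext a
    simp only [add_apply, sum_apply, smul_apply,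
      firstFace, lastFace, contract, MultilinearMap.coe_mk, map_smul, smul_add, Finset.smul_sum,
      RingHom.id_apply]
    simp only [smul_comm r]

/-- Hochschild `n`-cocycles. -/
def cocycles (c : BimoduleStr k A R M) (n : ℕ) : Submodule R (Cochain k A M n) :=
  LinearMap.ker (hochD c n)

/-- Hochschild `n`-coboundaries. -/
def coboundaries (c : BimoduleStr k A R M) : (n : ℕ) → Submodule R (Cochain k A M n)
  | 0 => ⊥
  | n + 1 => LinearMap.range (hochD c n)

/-- Hochschild cohomology `Hⁿ(A, M)`, with its `R`-module structure induced from `M`. -/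
abbrev HH (c : BimoduleStr k A R M) (n : ℕ) : Type (max v z) :=
  cocycles c n ⧸ (coboundaries c n).submoduleOf (cocycles c n)

/-- The class of a cocycle. -/
abbrev HH.mk (c : BimoduleStr k A R M) (n : ℕ) : cocycles c n →ₗ[R] HH c n :=
  ((coboundaries c n).submoduleOf (cocycles c n)).mkQ

end Hochschild

section Resolution

open CategoryTheory

/-- `A` has a projective resolution by finitely generated modules over `Aᵉ`, where
`(a ⊗ op b) • m = a m b`. -/
def HasFGProjectiveResolution (k : Type u) (A : Type v) [CommRing k] [Ring A] [Algebra k A] :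
    Prop :=
  letI : Module (Env k A) A := TensorProduct.Algebra.module
  ∃ P : ProjectiveResolution (ModuleCat.of.{v} (Env k A) A),
    ∀ n, Module.Finite (Env k A) (P.complex.X n)

end Resolution

section Ore

variable {k : Type u} {A E : Type v} [CommRing k] [Ring A] [Algebra k A] [Ring E] [Algebra k E]

/-- `δ` is a `σ`-derivation of `A`. -/
def IsSkewDerivation (σ : A →ₐ[k] A) (δ : A →ₗ[k] A) : Prop :=
  ∀ a b, δ (a * b) = δ a * b + σ a * δ b

/-- `E`, together with `ι : A → E` and `x : E`, is the Ore extension `A[x; σ, δ]`: the powers of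
`x` form a basis of `E` as a left `A`-module, and `x a = σ(a) x + δ(a)` for all `a ∈ A`. -/
structure IsOreExtension (σ : A →ₐ[k] A) (δ : A →ₗ[k] A) (ι : A →ₐ[k] E) (x : E) : Prop where
  basis : Function.Bijective fun p : ℕ →₀ A => p.sum fun i a => ι a * x ^ i
  comm : ∀ a, x * ι a = ι (σ a) * x + ι (δ a)

/-- If `X L(a) = L(σ(a)) X + L(δ(a))` in an algebra `D` and the powers of `X` are left linearly
independent over `A`, then `A` and `X` generate an Ore extension inside `D`. -/
theorem exists_isOreExtension_of_injective {D : Type v} [Ring D] [Algebra k D]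
    (σ : A →ₐ[k] A) (δ : A →ₗ[k] A) (L : A →ₐ[k] D) (X : D)
    (hcomm : ∀ a, X * L a = L (σ a) * X + L (δ a))
    (hinj : Function.Injective fun p : ℕ →₀ A => p.sum fun i a => L a * X ^ i) :
    ∃ (E : Type v) (_ : Ring E) (_ : Algebra k E) (ι : A →ₐ[k] E) (x : E),
      IsOreExtension σ δ ι x := by
  let Φ : (ℕ →₀ A) →ₗ[k] D := Finsupp.lsum k fun i => LinearMap.mulRight k (X ^ i) ∘ₗ L.toLinearMap
  have hΦs : ∀ i b, Φ (Finsupp.single i b) = L b * X ^ i := by intro i b; simp [Φ]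
  have hΦL : ∀ a p, ∃ q, L a * Φ p = Φ q := by
    intro a p
    induction p using Finsupp.induction_linear with
    | zero => exact ⟨0, by simp⟩
    | add p q hp hq =>
      obtain ⟨p', hp⟩ := hp
      obtain ⟨q', hq⟩ := hq
      exact ⟨p' + q', by simp only [map_add, mul_add, hp, hq]⟩
    | single i b => exact ⟨Finsupp.single i (a * b), by rw [hΦs, hΦs, map_mul, mul_assoc]⟩
  have hΦX : ∀ p, ∃ q, X * Φ p = Φ q := by
    intro p
    induction p using Finsupp.induction_linear with
    | zero => exact ⟨0, by simp⟩
    | add p q hp hq =>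
      obtain ⟨p', hp⟩ := hp
      obtain ⟨q', hq⟩ := hq
      exact ⟨p' + q', by simp only [map_add, mul_add, hp, hq]⟩
    | single i b =>
      exact ⟨Finsupp.single (i + 1) (σ b) + Finsupp.single i (δ b), by
        rw [hΦs, map_add, hΦs, hΦs, ← mul_assoc, hcomm, add_mul, mul_assoc, ← pow_succ']⟩
  let S : Subalgebra k D := Algebra.adjoin k (Set.range L ∪ {X})
  have hLS : ∀ a, L a ∈ S := fun a => Algebra.subset_adjoin (Or.inl ⟨a, rfl⟩)
  have hXS : X ∈ S := Algebra.subset_adjoin (Or.inr rfl)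
  have hS : ∀ T ∈ S, ∀ p, ∃ q, T * Φ p = Φ q := by
    intro T hT
    induction hT using Algebra.adjoin_induction with
    | mem T hT =>
      rcases hT with ⟨a, rfl⟩ | rfl
      · exact hΦL a
      · exact hΦX
    | algebraMap r => exact fun p => ⟨r • p, by rw [map_smul, Algebra.smul_def]⟩
    | add T T' _ _ h h' =>
      intro p
      obtain ⟨q, hq⟩ := h p
      obtain ⟨q', hq'⟩ := h' p
      exact ⟨q + q', by rw [add_mul, hq, hq', map_add]⟩
    | mul T T' _ _ h h' =>
      intro p
      obtain ⟨q, hq⟩ := h' p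
      obtain ⟨q', hq'⟩ := h q
      exact ⟨q', by rw [mul_assoc, hq, hq']⟩
  let ι : A →ₐ[k] S := L.codRestrict S hLS
  let x : S := ⟨X, hXS⟩
  have hval : ∀ p : ℕ →₀ A, ((p.sum fun i a => ι a * x ^ i : S) : D) =
      p.sum fun i a => L a * X ^ i := by
    intro p
    simp only [Finsupp.sum, AddSubmonoidClass.coe_finsetSum]
    rfl
  refine ⟨S, inferInstance, inferInstance, ι, x, ⟨⟨fun p q h => ?_, fun T => ?_⟩, fun a => ?_⟩⟩
  · refine hinj ?_
    change p.sum _ = q.sum _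
    rw [← hval, ← hval]
    exact congrArg _ h
  · obtain ⟨q, hq⟩ := hS T.1 T.2 (Finsupp.single 0 1)
    refine ⟨q, Subtype.ext ((hval q).trans ?_)⟩
    rw [hΦs, map_one, pow_zero, mul_one, mul_one] at hq
    rw [hq]
    rfl
  · exact Subtype.ext (hcomm a)

/-- Ore extensions exist: `A[x; σ, δ]` is realised by operators on `⨁ᵢ A xⁱ`. -/
theorem exists_isOreExtension (σ : A →ₐ[k] A) (δ : A →ₗ[k] A) (hδ : IsSkewDerivation σ δ) :
    ∃ (E : Type v) (_ : Ring E) (_ : Algebra k E) (ι : A →ₐ[k] E) (x : E),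
      IsOreExtension σ δ ι x := by
  let L : A →ₐ[k] Module.End k (ℕ →₀ A) := Algebra.lsmul k k (ℕ →₀ A)
  let X : Module.End k (ℕ →₀ A) :=
    Finsupp.lmapDomain A k Nat.succ ∘ₗ Finsupp.mapRange.linearMap σ.toLinearMap +
      Finsupp.mapRange.linearMap δ
  have hL : ∀ a i b, L a (Finsupp.single i b) = Finsupp.single i (a * b) := by
    intro a i b; simp [L]
  have hX : ∀ i b, X (Finsupp.single i b) =
      Finsupp.single (i + 1) (σ b) + Finsupp.single i (δ b) := by
    intro i b; simp [X, Finsupp.mapDomain_single]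
  have hcomm : ∀ a, X * L a = L (σ a) * X + L (δ a) := by
    intro a
    refine Finsupp.lhom_ext fun i b => ?_
    simp only [Module.End.mul_apply, LinearMap.add_apply, hL, hX, map_add, map_mul, hδ a b,
      Finsupp.single_add]
    abel
  have hδ1 : δ 1 = 0 := by simpa using hδ 1 1
  have hpow : ∀ i, (X ^ i) (Finsupp.single 0 1) = Finsupp.single i 1 := by
    intro i
    induction i with
    | zero => simp
    | succ i ih => rw [pow_succ', Module.End.mul_apply, ih, hX]; simp [hδ1]
  have hΦ : ∀ p : ℕ →₀ A, (p.sum fun i a => L a * X ^ i) (Finsupp.single 0 1) = p := by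
    intro p
    rw [Finsupp.sum, LinearMap.sum_apply]
    simp only [Module.End.mul_apply, hpow, hL, mul_one]
    exact p.sum_single
  exact exists_isOreExtension_of_injective σ δ L X hcomm fun p q h => by
    rw [← hΦ p, ← hΦ q]
    exact DFunLike.congr_fun h _

/-- For an `E`-bimodule `M`, the map `θ : Cⁿ(A, M) → Cⁿ(A, M^{σ⁻¹})` given by
`θ(f)(a₁, …, aₙ) = x · f(σ⁻¹a₁, …, σ⁻¹aₙ) - f(a₁, …, aₙ) · x
  - ∑ⱼ f(a₁, …, aⱼ₋₁, δσ⁻¹aⱼ, σ⁻¹aⱼ₊₁, …, σ⁻¹aₙ)`. -/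
def theta {R : Type w} {M : Type z} [Ring R] [Algebra k R]
    [AddCommGroup M] [Module k M] [Module R M] [IsScalarTower k R M]
    (c : BimoduleStr k E R M) (σ : A ≃ₐ[k] A) (δ : A →ₗ[k] A) (x : E) {n : ℕ}
    (f : Cochain k A M n) : Cochain k A M n :=
  ((c.lact x).restrictScalars k).compMultilinearMap
      (f.compLinearMap fun _ => σ.symm.toLinearMap) -
    ((c.ract x).restrictScalars k).compMultilinearMap f -
    ∑ j : Fin n, f.compLinearMap fun i =>
      if i < j then LinearMap.id
      else if i = j then δ ∘ₗ σ.symm.toLinearMap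
      else σ.symm.toLinearMap

end Ore
end OreHochschild

/-! For every unital `E`-bimodule `M`, Hochschild cochains of `E` are quasi-isomorphic to the
mapping cocone of `θ : C*(A, M) → C*(A, M^{σ⁻¹})`. The comparison map `conePhi` pairs the
restriction of a cochain to `A` with `eta`, the alternating sum of insertions of `x`; it is a
cochain map because `eta` is a null homotopy of `θ` on restricted cochains (`thetaRec_res`). That it
is a quasi-isomorphism (`conePhi_quasiIso`) follows by dimension shifting along `0 → M → Hom(E, M) →
coker → 0`: for coinduced coefficients both sides are acyclic in positive degrees (`coind_acyclic`,
`cone_acyclic`). The cocone then yields a long exact sequence, and it breaks into the required short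
ones once `θ` is injective on cohomology in degrees `n` and `n + 1`.

Injectivity is special to `M = E ⊗ E`. Filter by the degree in `x` of the first factor. If `f` has
degree at most `N`, the only contribution of `θ f` in degree `N + 1` is the leading term of `x f(σ⁻¹
-)`, and the operator `lower` recovers from it the top part of `f`. Hence if `θ f` is a coboundary,
so is the top part of `f`; subtract it and descend (`isCob_of_mem_filtration`).

A general cocycle has no degree bound, and here the finiteness of the resolution enters. In each
degree there is a cocycle `z` with values in a finitely generated bimodule (`A` or a syzygy) such
that every cocycle is cohomologous to `g ∘ z` for a bimodule map `g` (`exists_finite_isUniversal`).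
The image of `g` is finitely generated, so it lies in one step of the filtration
(`exists_isCob_sub_of_directed`).

Cochain identities are proved by induction on the number of variables: separating the last variable
identifies `Cⁿ⁺¹(A, M)` with `Cⁿ(A, Hom(A, M))` for a shifted bimodule structure. That structure is
not unital, which is why `BiAction` imposes no unit law. -/

namespace OreHochschild

/-! ### The Hochschild complex by recursion on the last variable -/

/-- A bimodule structure, not necessarily unital: commuting left and right actions of `A`. -/
structure BiAction (k : Type u) (A : Type v) (M : Type w) [CommRing k] [Ring A] [Algebra k A]
    [AddCommGroup M] [Module k M] where
  l : A →ₗ[k] M →ₗ[k] M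
  r : A →ₗ[k] M →ₗ[k] M
  l_mul : ∀ a b m, l (a * b) m = l a (l b m)
  r_mul : ∀ a b m, r (a * b) m = r b (r a m)
  comm : ∀ a b m, l a (r b m) = r b (l a m)

theorem snoc_init_last {A : Type v} {n : ℕ} (a : Fin (n + 1) → A) :
    (Fin.snoc (fun i => a i.castSucc) (a (Fin.last n)) : Fin (n + 1) → A) = a :=
  Fin.snoc_init_self a

section Post

variable {k : Type u} {A : Type v} [CommRing k] [Ring A] [Algebra k A]
  {M : Type w} [AddCommGroup M] [Module k M] {N : Type z} [AddCommGroup N] [Module k N]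

/-- Composition of cochains with a linear map of coefficients. -/
def post (φ : M →ₗ[k] N) {n : ℕ} : Cochain k A M n →ₗ[k] Cochain k A N n where
  toFun f := φ.compMultilinearMap f
  map_add' f g := by ext; simp
  map_smul' r f := by ext; simp

@[simp] theorem post_apply (φ : M →ₗ[k] N) {n : ℕ} (f : Cochain k A M n) (a : Fin n → A) :
    post φ f a = φ (f a) := rfl

theorem post_injective {φ : M →ₗ[k] N} (hφ : Function.Injective φ) (n : ℕ) :
    Function.Injective (post (A := A) φ (n := n)) := by
  intro f g h
  ext a
  exact hφ (DFunLike.congr_fun h a)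

variable (k A M) in
/-- Separation of the last variable of a cochain. -/
def cur (n : ℕ) : Cochain k A M (n + 1) ≃ₗ[k] Cochain k A (A →ₗ[k] M) n :=
  multilinearCurryRightEquiv k (fun _ : Fin (n + 1) => A) M

@[simp] theorem cur_apply {n : ℕ} (f : Cochain k A M (n + 1)) (a : Fin n → A) (c : A) :
    cur k A M n f a c = f (Fin.snoc a c : Fin (n + 1) → A) := rfl

@[simp] theorem cur_symm_apply {n : ℕ} (f : Cochain k A (A →ₗ[k] M) n) (a : Fin (n + 1) → A) :
    (cur k A M n).symm f a = f (fun i => a i.castSucc) (a (Fin.last n)) := rfl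

@[simp] theorem cur_post (φ : M →ₗ[k] N) {n : ℕ} (f : Cochain k A M (n + 1)) :
    cur k A N n (post φ f) = post (φ.compRight k) (cur k A M n f) := rfl

theorem cur_symm_post (φ : M →ₗ[k] N) {n : ℕ} (f : Cochain k A (A →ₗ[k] M) n) :
    (cur k A N n).symm (post (φ.compRight k) f) = post φ ((cur k A M n).symm f) := rfl

end Post

namespace BiAction

variable {k : Type u} {A : Type v} [CommRing k] [Ring A] [Algebra k A]
  {M : Type v} [AddCommGroup M] [Module k M] {N : Type v} [AddCommGroup N] [Module k N]

/-- The structure on `Hom(A, M)` for which separating the last variable of cochains commutes with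
the Hochschild differential: `(a j)(c) = a j(c)` and `(j a)(c) = j(a c) - j(a) c`. -/
def shift (c : BiAction k A M) : BiAction k A (A →ₗ[k] M) where
  l := LinearMap.mk₂ k (fun a j => c.l a ∘ₗ j) (by intros; ext; simp) (by intros; ext; simp)
    (by intros; ext; simp) (by intros; ext; simp)
  r := LinearMap.mk₂ k (fun a j => j ∘ₗ LinearMap.mulLeft k a - c.r.flip (j a))
    (by intros; ext; simp [add_mul]; abel) (by intros; ext; simp [smul_sub])
    (by intros; ext; simp; abel) (by intros; ext; simp [smul_sub])
  l_mul a b j := by ext; simp [c.l_mul]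
  r_mul a b j := by ext; simp [c.r_mul]
  comm a b j := by ext; simp [c.comm]

@[simp] theorem shift_l (c : BiAction k A M) (a : A) (j : A →ₗ[k] M) (b : A) :
    c.shift.l a j b = c.l a (j b) := rfl

@[simp] theorem shift_r (c : BiAction k A M) (a : A) (j : A →ₗ[k] M) (b : A) :
    c.shift.r a j b = j (a * b) - c.r b (j a) := rfl

/-- The Hochschild differential, by recursion on the number of variables. -/
def D : ∀ (n : ℕ) {M : Type v} [AddCommGroup M] [Module k M] (_ : BiAction k A M),
    Cochain k A M n →ₗ[k] Cochain k A M (n + 1)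
  | 0, M, _, _, c => (cur k A M 0).symm.toLinearMap ∘ₗ post (c.l.flip - c.r.flip)
  | n + 1, M, _, _, c =>
      (cur k A M (n + 1)).symm.toLinearMap ∘ₗ D n c.shift ∘ₗ (cur k A M n).toLinearMap

theorem D_zero (c : BiAction k A M) (f : Cochain k A M 0) :
    c.D 0 f = (cur k A M 0).symm (post (c.l.flip - c.r.flip) f) := rfl

theorem D_succ (c : BiAction k A M) (n : ℕ) (f : Cochain k A M (n + 1)) :
    c.D (n + 1) f = (cur k A M (n + 1)).symm (c.shift.D n (cur k A M n f)) := rfl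

theorem cur_D (c : BiAction k A M) (n : ℕ) (f : Cochain k A M (n + 1)) :
    cur k A M (n + 1) (c.D (n + 1) f) = c.shift.D n (cur k A M n f) := by
  rw [D_succ, LinearEquiv.apply_symm_apply]

/-- The differential and a map of coefficients which is left linear, and right linear up to a
defect `κ`. -/
theorem D_post_defect : ∀ (n : ℕ) {M N : Type v} [AddCommGroup M] [Module k M] [AddCommGroup N]
    [Module k N] (c : BiAction k A M) (c' : BiAction k A N) (ψ : M →ₗ[k] N)
    (κ : M →ₗ[k] A →ₗ[k] N) (_ : ∀ a m, ψ (c.l a m) = c'.l a (ψ m))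
    (_ : ∀ a m, ψ (c.r a m) = c'.r a (ψ m) - κ m a) (f : Cochain k A M n),
    c'.D n (post ψ f) = post ψ (c.D n f) + (-1 : ℤ) ^ (n + 1) • (cur k A N n).symm (post κ f)
  | 0, M, N, _, _, _, _, c, c', ψ, κ, hl, hr, f => by
    ext a
    simp [D_zero, hl, hr]
    abel
  | n + 1, M, N, _, _, _, _, c, c', ψ, κ, hl, hr, f => by
    -- The right action of the shifted structure contains `-j(a) c`, so the defect of `ψ ∘ -` is `-κ
    -- ∘ -`. This change of sign at each step produces `(-1) ^ (n + 1)`.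
    have h := D_post_defect n c.shift c'.shift (ψ.compRight k) (-κ.compRight k)
      (fun a j => by ext b; simp [hl]) (fun a j => by ext b; simp [hr]; abel) (cur k A M n f)
    rw [D_succ, cur_post, h, map_add, D_succ, cur_symm_post, map_zsmul, pow_succ _ (n + 1)]
    congr 1
    rw [mul_neg_one, neg_smul, ← smul_neg]
    congr 1
    ext a
    simp [snoc_init_last fun i => a (Fin.castSucc i)]

/-- A homomorphism of bimodules. -/
def IsHom (c : BiAction k A M) (c' : BiAction k A N) (φ : M →ₗ[k] N) : Prop :=
  (∀ a m, φ (c.l a m) = c'.l a (φ m)) ∧ ∀ a m, φ (c.r a m) = c'.r a (φ m)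

theorem D_post {c : BiAction k A M} {c' : BiAction k A N} {φ : M →ₗ[k] N} (h : c.IsHom c' φ)
    {n : ℕ} (f : Cochain k A M n) : c'.D n (post φ f) = post φ (c.D n f) := by
  rw [D_post_defect n c c' φ 0 h.1 (by simp [h.2]) f]
  have : post (0 : M →ₗ[k] A →ₗ[k] N) f = 0 := rfl
  simp [this]

/-- Only degree zero needs computation, and there associativity and commutation of the two actions
suffice; the unit plays no role. -/
theorem D_D : ∀ (n : ℕ) {M : Type v} [AddCommGroup M] [Module k M] (c : BiAction k A M)
    (f : Cochain k A M n), c.D (n + 1) (c.D n f) = 0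
  | 0, M, _, _, c, f => by
    ext a
    simp [D_succ, D_zero, c.l_mul, c.r_mul, c.comm]
  | n + 1, M, _, _, c, f => by
    rw [D_succ, cur_D, D_D n, map_zero]

theorem contractNth_snoc {n : ℕ} (j : Fin n) (a : Fin (n + 1) → A) (b : A) :
    Fin.contractNth j.castSucc.castSucc (· * ·) (Fin.snoc a b : Fin (n + 2) → A) =
      Fin.snoc (Fin.contractNth j.castSucc (· * ·) a) b := by
  ext i
  cases i using Fin.lastCases with
  | last =>
    simp only [Fin.contractNth, Fin.val_last, Fin.val_castSucc, Fin.snoc_last, Fin.succ_last]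
    rw [if_neg (by omega), if_neg (by omega)]
  | cast i =>
    simp only [Fin.contractNth, Fin.val_castSucc, Fin.snoc_castSucc, ← Fin.castSucc_succ]

theorem contractNth_last_snoc {n : ℕ} (a : Fin (n + 1) → A) (b : A) :
    Fin.contractNth (Fin.last n).castSucc (· * ·) (Fin.snoc a b : Fin (n + 2) → A) =
      Fin.snoc (fun i => a i.castSucc) (a (Fin.last n) * b) := by
  ext i
  cases i using Fin.lastCases with
  | last =>
    simp only [Fin.contractNth, Fin.val_last, Fin.val_castSucc, Fin.snoc_last, Fin.succ_last,
      Fin.snoc_castSucc]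
    simp
  | cast i =>
    simp only [Fin.contractNth, Fin.val_castSucc, Fin.snoc_castSucc, Fin.val_last]
    rw [if_pos i.2]

/-- In the inductive step the two terms of the shifted right action supply the contraction of the
last two variables and the last face. -/
theorem D_apply : ∀ (n : ℕ) {M : Type v} [AddCommGroup M] [Module k M] (c : BiAction k A M)
    (f : Cochain k A M n) (a : Fin (n + 1) → A), c.D n f a =
      c.l (a 0) (f fun i => a i.succ) +
        ∑ j : Fin n, (-1 : ℤ) ^ (j.val + 1) • f (Fin.contractNth j.castSucc (· * ·) a) +
        (-1 : ℤ) ^ (n + 1) • c.r (a (Fin.last n)) (f fun i => a i.castSucc)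
  | 0, M, _, _, c, f, a => by
    have h1 : (fun i : Fin 0 => a i.succ) = fun i => a i.castSucc := Subsingleton.elim _ _
    simp [D_zero, h1, sub_eq_add_neg]
  | n + 1, M, _, _, c, f, a => by
    obtain ⟨a, b, rfl⟩ : ∃ a' b, a = (Fin.snoc a' b : Fin (n + 2) → A) :=
      ⟨_, _, (snoc_init_last a).symm⟩
    rw [D_succ, cur_symm_apply, D_apply n]
    simp only [Fin.snoc_castSucc, Fin.snoc_last, LinearMap.add_apply, LinearMap.sum_apply,
      LinearMap.smul_apply, shift_l, shift_r, cur_apply, Fin.sum_univ_castSucc (n := n),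
      Fin.val_castSucc, Fin.val_last, contractNth_snoc, contractNth_last_snoc, snoc_init_last]
    have h0 : (Fin.snoc a b : Fin (n + 2) → A) 0 = a 0 :=
      Fin.snoc_castSucc (α := fun _ => A) b a 0
    have h1 : (fun i : Fin (n + 1) => (Fin.snoc a b : Fin (n + 2) → A) i.succ) =
        Fin.snoc (fun i : Fin n => a i.succ) b := by
      ext i
      cases i using Fin.lastCases with
      | last => simp
      | cast i => simp [← Fin.castSucc_succ]
    rw [h0, h1, pow_succ _ (n + 1), mul_neg_one, neg_smul, smul_sub]
    abel

end BiAction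

/-- The underlying actions of a bimodule. -/
def BimoduleStr.toBi {k : Type u} {A : Type v} {R : Type w} {M : Type z}
    [CommRing k] [Ring A] [Algebra k A] [Ring R] [Algebra k R]
    [AddCommGroup M] [Module k M] [Module R M] [IsScalarTower k R M]
    (c : BimoduleStr k A R M) : BiAction k A M where
  l := LinearMap.mk₂ k (fun a m => c.lact a m) (by simp [lact_add]) (by simp [lact_smul])
    (by simp) (by simp)
  r := LinearMap.mk₂ k (fun a m => c.ract a m) (by simp [ract_add]) (by simp [ract_smul])
    (by simp) (by simp)
  l_mul a b m := by
    simp only [LinearMap.mk₂_apply, BimoduleStr.lact, ← Module.End.mul_apply, ← map_mul]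
    simp
  r_mul a b m := by
    simp only [LinearMap.mk₂_apply, BimoduleStr.ract, ← Module.End.mul_apply, ← map_mul]
    simp
  comm a b m := by
    simp only [LinearMap.mk₂_apply, BimoduleStr.lact, BimoduleStr.ract, ← Module.End.mul_apply,
      ← map_mul]
    simp

@[simp] theorem BimoduleStr.toBi_l {k : Type u} {A : Type v} {R : Type w} {M : Type z}
    [CommRing k] [Ring A] [Algebra k A] [Ring R] [Algebra k R]
    [AddCommGroup M] [Module k M] [Module R M] [IsScalarTower k R M]
    (c : BimoduleStr k A R M) (a : A) (m : M) : c.toBi.l a m = c.lact a m := rfl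

@[simp] theorem BimoduleStr.toBi_r {k : Type u} {A : Type v} {R : Type w} {M : Type z}
    [CommRing k] [Ring A] [Algebra k A] [Ring R] [Algebra k R]
    [AddCommGroup M] [Module k M] [Module R M] [IsScalarTower k R M]
    (c : BimoduleStr k A R M) (a : A) (m : M) : c.toBi.r a m = c.ract a m := rfl

theorem hochD_eq_D {k : Type u} {A : Type v} {R : Type w} {M : Type v}
    [CommRing k] [Ring A] [Algebra k A] [Ring R] [Algebra k R]
    [AddCommGroup M] [Module k M] [Module R M] [IsScalarTower k R M]
    (c : BimoduleStr k A R M) (n : ℕ) (f : Cochain k A M n) : hochD c n f = c.toBi.D n f := by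
  ext a
  rw [BiAction.D_apply]
  simp [hochD, firstFace, lastFace, contract]

end OreHochschild

/-! ### Restriction of cochains along algebra maps -/

namespace OreHochschild

namespace BiAction

variable {k : Type u} {A E : Type v} [CommRing k] [Ring A] [Algebra k A] [Ring E] [Algebra k E]
  {M : Type v} [AddCommGroup M] [Module k M] {N : Type v} [AddCommGroup N] [Module k N]

/-- Restriction of the left and right actions along algebra homomorphisms. -/
def pull (c : BiAction k E M) (ι κ : A →ₐ[k] E) : BiAction k A M where
  l := c.l ∘ₗ ι.toLinearMap
  r := c.r ∘ₗ κ.toLinearMap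
  l_mul a b m := by simp [c.l_mul]
  r_mul a b m := by simp [c.r_mul]
  comm a b m := by simp [c.comm]

@[simp] theorem pull_l (c : BiAction k E M) (ι κ : A →ₐ[k] E) (a : A) (m : M) :
    (c.pull ι κ).l a m = c.l (ι a) m := rfl

@[simp] theorem pull_r (c : BiAction k E M) (ι κ : A →ₐ[k] E) (a : A) (m : M) :
    (c.pull ι κ).r a m = c.r (κ a) m := rfl

theorem IsHom.pull {c : BiAction k E M} {c' : BiAction k E N} {φ : M →ₗ[k] N} (h : c.IsHom c' φ)
    (ι κ : A →ₐ[k] E) : (c.pull ι κ).IsHom (c'.pull ι κ) φ :=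
  ⟨fun _ _ => h.1 _ _, fun _ _ => h.2 _ _⟩

end BiAction

section Res

variable {k : Type u} {A E : Type v} [CommRing k] [Ring A] [Algebra k A] [Ring E] [Algebra k E]
  {M : Type w} [AddCommGroup M] [Module k M] {N : Type z} [AddCommGroup N] [Module k N]

/-- Restriction of cochains along an algebra homomorphism. -/
def res (ι : A →ₐ[k] E) {n : ℕ} : Cochain k E M n →ₗ[k] Cochain k A M n where
  toFun f := f.compLinearMap fun _ => ι.toLinearMap
  map_add' f g := by ext; simp
  map_smul' r f := by ext; simp

@[simp] theorem res_apply (ι : A →ₐ[k] E) {n : ℕ} (f : Cochain k E M n) (a : Fin n → A) :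
    res ι f a = f fun i => ι (a i) := rfl

theorem comp_snoc {A : Type v} {B : Type w} (g : A → B) {n : ℕ} (a : Fin n → A) (b : A) :
    (fun i => g ((Fin.snoc a b : Fin (n + 1) → A) i)) =
      (Fin.snoc (fun i => g (a i)) (g b) : Fin (n + 1) → B) := by
  ext i
  cases i using Fin.lastCases <;> simp

/-- The separated last variable must be restricted too, now as a change of coefficients from `Hom(E,
M)` to `Hom(A, M)`. -/
theorem cur_res (ι : A →ₐ[k] E) {n : ℕ} (f : Cochain k E M (n + 1)) :
    cur k A M n (res ι f) = post (LinearMap.lcomp k M ι.toLinearMap) (res ι (cur k E M n f)) := by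
  ext a b
  simp [comp_snoc ι]

end Res

theorem BiAction.D_res {k : Type u} {A E : Type v} [CommRing k] [Ring A] [Algebra k A] [Ring E]
    [Algebra k E] (ι : A →ₐ[k] E) : ∀ (n : ℕ) {M : Type v} [AddCommGroup M] [Module k M]
    (c : BiAction k E M) (f : Cochain k E M n), (c.pull ι ι).D n (res ι f) = res ι (c.D n f)
  | 0, M, _, _, c, f => by
    ext a
    simp only [D_zero, cur_symm_apply, post_apply, res_apply]
    simp
  | n + 1, M, _, _, c, f => by
    refine (cur k A M (n + 1)).injective ?_
    have h : ((c.shift).pull ι ι).IsHom (c.pull ι ι).shift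
        (LinearMap.lcomp k M ι.toLinearMap) :=
      ⟨fun a j => by ext; simp, fun a j => by ext; simp⟩
    rw [cur_D, cur_res, cur_res, cur_D, D_post h, D_res]

/-! ### The map `θ` is a cochain map -/

section Theta

variable {k : Type u} {A : Type v} [CommRing k] [Ring A] [Algebra k A]
  (σ : A ≃ₐ[k] A) (δ : A →ₗ[k] A)

/-- The map `θ`, for general operators `Xl`, `Xr` and `Y` in place of `m ↦ x m`, `m ↦ m x` and
the identity, by recursion on the number of variables. -/
def thetaRec : ∀ (n : ℕ) {M N : Type v} [AddCommGroup M] [Module k M] [AddCommGroup N]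
    [Module k N] (_ _ _ : M →ₗ[k] N), Cochain k A M n →ₗ[k] Cochain k A N n
  | 0, _, _, _, _, _, _, Xl, Xr, _ => post (Xl - Xr)
  | n + 1, M, N, _, _, _, _, Xl, Xr, Y =>
      (cur k A N n).symm.toLinearMap ∘ₗ
        thetaRec n (Xl.compRight k ∘ₗ LinearMap.lcomp k M σ.symm.toLinearMap)
          (Xr.compRight k + Y.compRight k ∘ₗ LinearMap.lcomp k M (δ ∘ₗ σ.symm.toLinearMap))
          (Y.compRight k ∘ₗ LinearMap.lcomp k M σ.symm.toLinearMap) ∘ₗ (cur k A M n).toLinearMap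

/-- The summand with `δσ⁻¹` in the last variable is absorbed into the new `Xr`. In all other
summands the last variable meets `σ⁻¹`, which is what the new `Y` records. -/
theorem thetaRec_apply : ∀ (n : ℕ) {M N : Type v} [AddCommGroup M] [Module k M] [AddCommGroup N]
    [Module k N] (Xl Xr Y : M →ₗ[k] N) (f : Cochain k A M n) (a : Fin n → A),
    thetaRec σ δ n Xl Xr Y f a = Xl (f fun i => σ.symm (a i)) - Xr (f a) -
      ∑ j : Fin n, Y (f fun i => if i < j then a i else if i = j then δ (σ.symm (a i))
        else σ.symm (a i))
  | 0, M, N, _, _, _, _, Xl, Xr, Y, f, a => by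
    have : (fun i => σ.symm (a i)) = a := Subsingleton.elim _ _
    simp [thetaRec, this]
  | n + 1, M, N, _, _, _, _, Xl, Xr, Y, f, a => by
    obtain ⟨a, b, rfl⟩ : ∃ a' b, a = (Fin.snoc a' b : Fin (n + 1) → A) :=
      ⟨_, _, (snoc_init_last a).symm⟩
    have h1 : ∀ j : Fin n, (fun i : Fin (n + 1) => if i < j.castSucc
        then (Fin.snoc a b : Fin (n + 1) → A) i else if i = j.castSucc
        then δ (σ.symm ((Fin.snoc a b : Fin (n + 1) → A) i))
        else σ.symm ((Fin.snoc a b : Fin (n + 1) → A) i)) = Fin.snoc (fun i => if i < j then a i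
        else if i = j then δ (σ.symm (a i)) else σ.symm (a i)) (σ.symm b) := by
      intro j
      ext i
      cases i using Fin.lastCases with
      | last => simp [Fin.le_last, (Fin.castSucc_lt_last j).ne']
      | cast i => simp
    have h2 : (fun i : Fin (n + 1) => if i < Fin.last n
        then (Fin.snoc a b : Fin (n + 1) → A) i else if i = Fin.last n
        then δ (σ.symm ((Fin.snoc a b : Fin (n + 1) → A) i))
        else σ.symm ((Fin.snoc a b : Fin (n + 1) → A) i)) = Fin.snoc a (δ (σ.symm b)) := by
      ext i
      cases i using Fin.lastCases with
      | last => simp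
      | cast i => simp [Fin.castSucc_lt_last]
    rw [Fin.sum_univ_castSucc]
    simp only [h1, h2, comp_snoc σ.symm]
    simp only [thetaRec, LinearMap.comp_apply, LinearEquiv.coe_coe, cur_symm_apply,
      Fin.snoc_castSucc, Fin.snoc_last, thetaRec_apply n, LinearMap.sub_apply,
      LinearMap.sum_apply, LinearMap.add_apply, LinearMap.compRight_apply,
      LinearMap.lcomp_apply, cur_apply, AlgEquiv.toLinearMap_apply]
    abel

theorem thetaRec_post_defect : ∀ (n : ℕ) {M N M' N' : Type v} [AddCommGroup M] [Module k M]
    [AddCommGroup N] [Module k N] [AddCommGroup M'] [Module k M'] [AddCommGroup N'] [Module k N']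
    (Xl Xr Y : M →ₗ[k] N) (Xl' Xr' Y' : M' →ₗ[k] N') (φ : M →ₗ[k] M') (ψ : N →ₗ[k] N')
    (ε : M →ₗ[k] N') (_ : ∀ m, ψ (Xl m) = Xl' (φ m))
    (_ : ∀ m, ψ (Xr m) = Xr' (φ m) + ε m) (_ : ∀ m, ψ (Y m) = Y' (φ m)) (f : Cochain k A M n),
    thetaRec σ δ n Xl' Xr' Y' (post φ f) = post ψ (thetaRec σ δ n Xl Xr Y f) + post ε f := by
  intro n M N M' N' _ _ _ _ _ _ _ _ Xl Xr Y Xl' Xr' Y' φ ψ ε hl hr hY f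
  ext a
  simp [thetaRec_apply, hl, hr, hY]
  abel

theorem cur_thetaRec (n : ℕ) {M N : Type v} [AddCommGroup M] [Module k M] [AddCommGroup N]
    [Module k N] (Xl Xr Y : M →ₗ[k] N) (f : Cochain k A M (n + 1)) :
    cur k A N n (thetaRec σ δ (n + 1) Xl Xr Y f) =
      thetaRec σ δ n (Xl.compRight k ∘ₗ LinearMap.lcomp k M σ.symm.toLinearMap)
        (Xr.compRight k + Y.compRight k ∘ₗ LinearMap.lcomp k M (δ ∘ₗ σ.symm.toLinearMap))
        (Y.compRight k ∘ₗ LinearMap.lcomp k M σ.symm.toLinearMap) (cur k A M n f) :=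
  LinearEquiv.apply_symm_apply _ _

/-- The relations satisfied by `m ↦ x m`, `m ↦ m x` and the identity for a bimodule over an Ore
extension with the twisted bimodule as target. -/
structure IsSkew {M N : Type v} [AddCommGroup M] [Module k M] [AddCommGroup N] [Module k N]
    (c : BiAction k A M) (c' : BiAction k A N) (Xl Xr Y : M →ₗ[k] N) : Prop where
  Xl_l : ∀ a m, Xl (c.l a m) = c'.l (σ a) (Xl m) + c'.l (δ a) (Y m)
  Xl_r : ∀ a m, Xl (c.r a m) = c'.r (σ a) (Xl m)
  Xr_l : ∀ a m, Xr (c.l a m) = c'.l a (Xr m)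
  Xr_r : ∀ a m, Xr (c.r a m) = c'.r a (Xr m) - Y (c.r (δ (σ.symm a)) m)
  Y_l : ∀ a m, Y (c.l a m) = c'.l a (Y m)
  Y_r : ∀ a m, Y (c.r a m) = c'.r (σ a) (Y m)

variable {σ δ}

/-- The relations must survive separation of a variable for the induction to run. The skew Leibniz
rule is needed only for `Xr_r`, to expand `δσ⁻¹(ab)`. -/
theorem IsSkew.shift (hδ : IsSkewDerivation (σ : A →ₐ[k] A) δ)
    {M N : Type v} [AddCommGroup M] [Module k M] [AddCommGroup N] [Module k N]
    {c : BiAction k A M} {c' : BiAction k A N} {Xl Xr Y : M →ₗ[k] N}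
    (h : IsSkew σ δ c c' Xl Xr Y) : IsSkew σ δ c.shift c'.shift
      (Xl.compRight k ∘ₗ LinearMap.lcomp k M σ.symm.toLinearMap)
      (Xr.compRight k + Y.compRight k ∘ₗ LinearMap.lcomp k M (δ ∘ₗ σ.symm.toLinearMap))
      (Y.compRight k ∘ₗ LinearMap.lcomp k M σ.symm.toLinearMap) where
  Xl_l a j := by ext b; simp [h.Xl_l]
  Xl_r a j := by ext b; simp [h.Xl_r]
  Xr_l a j := by ext b; simp [h.Xr_l, h.Y_l]
  Xr_r a j := by
    ext b
    have := hδ (σ.symm a) (σ.symm b)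
    simp at this
    simp [h.Xr_r, h.Y_r, this]
    abel
  Y_l a j := by ext b; simp [h.Y_l]
  Y_r a j := by ext b; simp [h.Y_r]

theorem thetaRec_D (hδ : IsSkewDerivation (σ : A →ₐ[k] A) δ) : ∀ (n : ℕ)
    {M N : Type v} [AddCommGroup M] [Module k M] [AddCommGroup N] [Module k N]
    {c : BiAction k A M} {c' : BiAction k A N} {Xl Xr Y : M →ₗ[k] N}
    (_ : IsSkew σ δ c c' Xl Xr Y) (f : Cochain k A M n),
    thetaRec σ δ (n + 1) Xl Xr Y (c.D n f) = c'.D n (thetaRec σ δ n Xl Xr Y f)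
  | 0, M, N, _, _, _, _, c, c', Xl, Xr, Y, h, f => by
    ext a
    simp [thetaRec, BiAction.D_zero, h.Xl_l, h.Xl_r, h.Xr_l, h.Xr_r, h.Y_l]
    abel
  | n + 1, M, N, _, _, _, _, c, c', Xl, Xr, Y, h, f => by
    refine (cur k A N (n + 1)).injective ?_
    rw [cur_thetaRec, BiAction.cur_D, thetaRec_D hδ n (h.shift hδ), BiAction.cur_D, cur_thetaRec]

end Theta

/-! ### Insertion of `x` as a null homotopy of `θ` -/

section Eta

variable {k : Type u} {A E : Type v} [CommRing k] [Ring A] [Algebra k A] [Ring E] [Algebra k E]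
  (σ : A ≃ₐ[k] A) (ι : A →ₐ[k] E) (x : E)

/-- The alternating sum of the insertions of `x`:
`F ↦ ∑ⱼ (-1)ʲ F(a₁, …, aⱼ, x, σ⁻¹aⱼ₊₁, …, σ⁻¹aₙ)`. -/
def eta : ∀ (n : ℕ) {M : Type v} [AddCommGroup M] [Module k M],
    Cochain k E M (n + 1) →ₗ[k] Cochain k A M n
  | 0, M, _, _ => post (LinearMap.applyₗ x) ∘ₗ res ι ∘ₗ (cur k E M 0).toLinearMap
  | n + 1, M, _, _ =>
    (cur k A M n).symm.toLinearMap ∘ₗ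
        post (LinearMap.lcomp k M (ι.comp (σ.symm : A →ₐ[k] A)).toLinearMap) ∘ₗ
        eta n ∘ₗ (cur k E M (n + 1)).toLinearMap +
      (-1 : ℤ) ^ (n + 1) •
        (post (LinearMap.applyₗ x) ∘ₗ res ι ∘ₗ (cur k E M (n + 1)).toLinearMap)

theorem eta_zero {M : Type v} [AddCommGroup M] [Module k M] (F : Cochain k E M 1) :
    eta σ ι x 0 F = post (LinearMap.applyₗ x) (res ι (cur k E M 0 F)) := rfl

theorem eta_succ {M : Type v} [AddCommGroup M] [Module k M] (n : ℕ) (F : Cochain k E M (n + 2)) :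
    eta σ ι x (n + 1) F =
      (cur k A M n).symm (post (LinearMap.lcomp k M (ι.comp (σ.symm : A →ₐ[k] A)).toLinearMap)
        (eta σ ι x n (cur k E M (n + 1) F))) +
      (-1 : ℤ) ^ (n + 1) • post (LinearMap.applyₗ x) (res ι (cur k E M (n + 1) F)) := rfl

theorem eta_post : ∀ (n : ℕ) {M N : Type v} [AddCommGroup M] [Module k M] [AddCommGroup N]
    [Module k N] (φ : M →ₗ[k] N) (F : Cochain k E M (n + 1)),
    eta σ ι x n (post φ F) = post φ (eta σ ι x n F)
  | 0, M, N, _, _, _, _, φ, F => rfl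
  | n + 1, M, N, _, _, _, _, φ, F => by
    rw [eta_succ, cur_post, eta_post n, eta_succ, map_add, map_zsmul]
    rfl

/-- The differential of `eta`. -/
def etaBd (n : ℕ) {M : Type v} [AddCommGroup M] [Module k M] (c : BiAction k E M)
    (F : Cochain k E M n) : Cochain k A M n :=
  match n, F with
  | 0, _ => 0
  | n + 1, F => (c.pull ι (ι.comp (σ.symm : A →ₐ[k] A))).D n (eta σ ι x n F)

variable {σ ι x} {δ : A →ₗ[k] A} (hx : ∀ a, x * ι a = ι (σ a) * x + ι (δ a))
include hx

/-- The relations come from commuting `x` past `A`; for `Xr_r`, use `a x = x σ⁻¹(a) - δσ⁻¹(a)`. -/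
theorem isSkew_of_ore {M : Type v} [AddCommGroup M] [Module k M] (c : BiAction k E M) :
    IsSkew σ δ (c.pull ι ι) (c.pull ι (ι.comp (σ.symm : A →ₐ[k] A))) (c.l x) (c.r x)
      LinearMap.id where
  Xl_l a m := by simp [← c.l_mul, hx]
  Xl_r a m := by simp [c.comm]
  Xr_l a m := by simp [c.comm]
  Xr_r a m := by
    have := hx (σ.symm a)
    simp at this
    simp [← c.r_mul, this]
  Y_l a m := by simp
  Y_r a m := by simp

/-- On cochains restricted from the Ore extension, `θ` is null homotopic. -/
theorem thetaRec_res : ∀ (n : ℕ) {M : Type v} [AddCommGroup M] [Module k M] (c : BiAction k E M)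
    (F : Cochain k E M n), thetaRec σ δ n (c.l x) (c.r x) LinearMap.id (res ι F) =
      eta σ ι x n (c.D n F) + etaBd σ ι x n c F
  | 0, M, _, _, c, F => by
    ext a
    simp [thetaRec, eta, etaBd, BiAction.D_zero]
  | n + 1, M, _, _, c, F => by
    set f := cur k E M n F with hf
    set ρ₂ := LinearMap.lcomp k M (ι.comp (σ.symm : A →ₐ[k] A)).toLinearMap with hρ₂
    set cσ := c.pull ι (ι.comp (σ.symm : A →ₐ[k] A)) with hcσ
    have ih := thetaRec_res n c.shift f
    -- The same `κ` measures two failures: of evaluation at `x` to be right linear (`hκ`), and, up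
    -- to sign, of restriction along `ι σ⁻¹` to intertwine the two versions of right multiplication
    -- by `x` (`hθ`). The two corrections therefore match in the final comparison.
    let κ : (E →ₗ[k] M) →ₗ[k] A →ₗ[k] M := LinearMap.mk₂ k
      (fun j a => c.r (ι (σ.symm a)) (j x) - j (ι a * x) + c.r x (j (ι a)))
      (by intros; simp; abel) (by intros; simp [smul_sub]) (by intros; simp [add_mul]; abel)
      (by intros; simp [smul_sub])
    have hκ : cσ.D n (post (LinearMap.applyₗ x) (res ι f)) =
        post (LinearMap.applyₗ x) (res ι (c.shift.D n f)) +
          (-1 : ℤ) ^ (n + 1) • (cur k A M n).symm (post κ (res ι f)) := by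
      rw [BiAction.D_post_defect n (c.shift.pull ι ι) cσ (LinearMap.applyₗ x) κ
        (fun a j => by simp [hcσ]) (fun a j => by simp [hcσ, κ]; abel) (res ι f), BiAction.D_res]
    have hθ := thetaRec_post_defect σ δ n (c.shift.l x) (c.shift.r x) LinearMap.id
      ((c.l x).compRight k ∘ₗ LinearMap.lcomp k M σ.symm.toLinearMap)
      ((c.r x).compRight k + LinearMap.id.compRight k ∘ₗ
        LinearMap.lcomp k M (δ ∘ₗ σ.symm.toLinearMap))
      (LinearMap.id.compRight k ∘ₗ LinearMap.lcomp k M σ.symm.toLinearMap)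
      (LinearMap.lcomp k M ι.toLinearMap) ρ₂ (-κ) (fun j => by ext a; simp [hρ₂])
      (fun j => by
        ext a
        have := hx (σ.symm a)
        simp at this
        simp [hρ₂, κ, this]
        abel) (fun j => by ext a; simp [hρ₂]) (res ι f)
    -- Split `eta` into insertions before the last variable and the insertion after it. For `n = 0`
    -- only the latter exists, hence the case distinction.
    have hbd : cur k A M n (cσ.D n (eta σ ι x n F)) =
        post ρ₂ (etaBd σ ι x n c.shift f) - post κ (res ι f) +
          (-1 : ℤ) ^ n • cur k A M n (post (LinearMap.applyₗ x) (res ι (c.shift.D n f))) := by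
      cases n with
      | zero =>
        rw [eta_zero, ← hf, hκ]
        simp [etaBd]
        abel
      | succ m =>
        have hhom : (c.shift.pull ι (ι.comp (σ.symm : A →ₐ[k] A))).IsHom cσ.shift ρ₂ :=
          ⟨fun a j => by ext; simp [hcσ, hρ₂], fun a j => by ext; simp [hcσ, hρ₂]⟩
        have hs : ((-1 : ℤ) ^ (m + 1)) * (-1) ^ (m + 1 + 1) = -1 := by
          rw [pow_succ _ (m + 1), ← mul_assoc, ← mul_pow]
          simp
        rw [eta_succ, ← hf, ← hρ₂, map_add, map_zsmul, hκ, BiAction.D_succ,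
          LinearEquiv.apply_symm_apply, BiAction.D_post hhom, map_add, map_zsmul,
          LinearEquiv.apply_symm_apply, map_add, map_zsmul, smul_add, smul_smul, hs,
          LinearEquiv.apply_symm_apply]
        simp [etaBd]
        abel
    refine (cur k A M n).injective ?_
    rw [cur_thetaRec, cur_res, ← hf, hθ, ih, map_add, eta_succ, BiAction.cur_D, ← hf, ← hρ₂,
      map_add, map_add, LinearEquiv.apply_symm_apply, map_zsmul, etaBd, hbd, pow_succ]
    have : post (-κ) (res ι f) = -post κ (res ι f) := rfl
    rw [this]
    simp
    abel

end Eta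

end OreHochschild

/-! ### Coinduced bimodules and their acyclicity -/

namespace OreHochschild

namespace BiAction

section Coinduced

variable {k : Type u} {A E : Type v} [CommRing k] [Ring A] [Algebra k A] [Ring E] [Algebra k E]
  {M : Type v} [AddCommGroup M] [Module k M] {N : Type v} [AddCommGroup N] [Module k N]

/-- Being a coboundary. -/
def IsCob (c : BiAction k A M) : (n : ℕ) → Cochain k A M n → Prop
  | 0, f => f = 0
  | n + 1, f => ∃ g, c.D n g = f

theorem IsCob.sub {c : BiAction k A M} {n : ℕ} {f g : Cochain k A M n} (hf : c.IsCob n f)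
    (hg : c.IsCob n g) : c.IsCob n (f - g) := by
  cases n with
  | zero => rw [IsCob] at *; rw [hf, hg, sub_zero]
  | succ n =>
    obtain ⟨f', rfl⟩ := hf
    obtain ⟨g', rfl⟩ := hg
    exact ⟨f' - g', map_sub _ _ _⟩

theorem IsCob.of_sub {c : BiAction k A M} {n : ℕ} {f g : Cochain k A M n}
    (h : c.IsCob n (f - g)) (hg : c.IsCob n g) : c.IsCob n f := by
  have h0 : c.IsCob n 0 := sub_self g ▸ hg.sub hg
  simpa using h.sub (h0.sub hg)

theorem IsCob.post {c : BiAction k A M} {c' : BiAction k A N} {φ : M →ₗ[k] N} (h : c.IsHom c' φ)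
    {n : ℕ} {f : Cochain k A M n} (hf : c.IsCob n f) : c'.IsCob n (post φ f) := by
  cases n with
  | zero => rw [IsCob] at *; rw [hf, map_zero]
  | succ n =>
    obtain ⟨f', rfl⟩ := hf
    exact ⟨OreHochschild.post φ f', D_post h f'⟩

theorem IsCob.res {c : BiAction k E M} (ι : A →ₐ[k] E) {n : ℕ} {f : Cochain k E M n}
    (hf : c.IsCob n f) : (c.pull ι ι).IsCob n (res ι f) := by
  cases n with
  | zero => rw [IsCob] at *; rw [hf, map_zero]
  | succ n =>
    obtain ⟨f', rfl⟩ := hf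
    exact ⟨OreHochschild.res ι f', D_res ι n c f'⟩

/-- The unit acts as the identity on both sides. -/
def Unital (c : BiAction k A M) : Prop :=
  (∀ m, c.l 1 m = m) ∧ ∀ m, c.r 1 m = m

/-- The coinduced structure `(a j b)(u) = a j(b u)` on `Hom(E, M)`. -/
def coind (c : BiAction k E M) : BiAction k E (E →ₗ[k] M) where
  l := LinearMap.mk₂ k (fun a j => c.l a ∘ₗ j) (by intros; ext; simp) (by intros; ext; simp)
    (by intros; ext; simp) (by intros; ext; simp)
  r := LinearMap.mk₂ k (fun a j => j ∘ₗ LinearMap.mulLeft k a) (by intros; ext; simp [add_mul])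
    (by intros; ext; simp) (by intros; ext; simp) (by intros; ext; simp)
  l_mul a b j := by ext; simp [c.l_mul]
  r_mul a b j := by ext; simp
  comm a b j := by ext; simp

@[simp] theorem coind_l (c : BiAction k E M) (a : E) (j : E →ₗ[k] M) (b : E) :
    c.coind.l a j b = c.l a (j b) := rfl

@[simp] theorem coind_r (c : BiAction k E M) (a : E) (j : E →ₗ[k] M) (b : E) :
    c.coind.r a j b = j (a * b) := rfl

theorem coind_unital {c : BiAction k E M} (h : c.Unital) : c.coind.Unital :=
  ⟨fun j => by ext; simp [h.1], fun j => by ext; simp⟩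

/-- The embedding of a bimodule into the coinduced one, `m ↦ (u ↦ m u)`. -/
abbrev emb (c : BiAction k E M) : M →ₗ[k] E →ₗ[k] M := c.r.flip

theorem isHom_emb (c : BiAction k E M) : c.IsHom c.coind c.emb :=
  ⟨fun a m => by ext; simp [c.comm], fun a m => by ext; simp [c.r_mul]⟩

theorem emb_injective {c : BiAction k E M} (h : c.Unital) : Function.Injective c.emb := by
  intro m m' hm
  simpa [h.2] using DFunLike.congr_fun hm 1

/-- The cokernel of the embedding into the coinduced bimodule. -/
abbrev Coker (c : BiAction k E M) : Type v := (E →ₗ[k] M) ⧸ LinearMap.range c.emb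

/-- The action induced on a quotient by a stable submodule. -/
def quotAct (L : A →ₗ[k] M →ₗ[k] M) (S : Submodule k M) (hS : ∀ a, ∀ m ∈ S, L a m ∈ S) :
    A →ₗ[k] M ⧸ S →ₗ[k] M ⧸ S where
  toFun a := S.mapQ S (L a) (hS a)
  map_add' a b := by
    refine Submodule.linearMap_qext _ (LinearMap.ext fun m => ?_)
    simp only [LinearMap.comp_apply, Submodule.mkQ_apply, Submodule.mapQ_apply, map_add,
      LinearMap.add_apply, Submodule.Quotient.mk_add]
  map_smul' r a := by
    refine Submodule.linearMap_qext _ (LinearMap.ext fun m => ?_)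
    simp only [LinearMap.comp_apply, Submodule.mkQ_apply, Submodule.mapQ_apply, map_smul,
      LinearMap.smul_apply, Submodule.Quotient.mk_smul, RingHom.id_apply]

theorem quotAct_mkQ (L : A →ₗ[k] M →ₗ[k] M) (S : Submodule k M) (hS : ∀ a, ∀ m ∈ S, L a m ∈ S)
    (a : A) (m : M) : quotAct L S hS a (S.mkQ m) = S.mkQ (L a m) := rfl

/-- The bimodule structure on a quotient by a stable submodule. -/
def quot (c : BiAction k A M) (S : Submodule k M) (hl : ∀ a, ∀ m ∈ S, c.l a m ∈ S)
    (hr : ∀ a, ∀ m ∈ S, c.r a m ∈ S) : BiAction k A (M ⧸ S) where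
  l := quotAct c.l S hl
  r := quotAct c.r S hr
  l_mul a b q := by
    obtain ⟨m, rfl⟩ := S.mkQ_surjective q
    simp only [quotAct_mkQ, c.l_mul]
  r_mul a b q := by
    obtain ⟨m, rfl⟩ := S.mkQ_surjective q
    simp only [quotAct_mkQ, c.r_mul]
  comm a b q := by
    obtain ⟨m, rfl⟩ := S.mkQ_surjective q
    simp only [quotAct_mkQ, c.comm]

/-- The bimodule structure on the cokernel of the embedding into the coinduced bimodule. -/
def coker (c : BiAction k E M) : BiAction k E c.Coker :=
  c.coind.quot _ (by rintro a _ ⟨m, rfl⟩; exact ⟨c.l a m, c.isHom_emb.1 a m⟩)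
    (by rintro a _ ⟨m, rfl⟩; exact ⟨c.r a m, c.isHom_emb.2 a m⟩)

/-- The projection from the coinduced bimodule. -/
abbrev proj (c : BiAction k E M) : (E →ₗ[k] M) →ₗ[k] c.Coker := Submodule.mkQ _

theorem isHom_proj (c : BiAction k E M) : c.coind.IsHom c.coker c.proj :=
  ⟨fun _ _ => rfl, fun _ _ => rfl⟩

theorem proj_surjective (c : BiAction k E M) : Function.Surjective c.proj :=
  Submodule.mkQ_surjective _

theorem coker_unital {c : BiAction k E M} (h : c.Unital) : c.coker.Unital :=
  ⟨fun q => by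
    obtain ⟨j, rfl⟩ := c.proj_surjective q
    rw [← c.isHom_proj.1, (coind_unital h).1],
  fun q => by
    obtain ⟨j, rfl⟩ := c.proj_surjective q
    rw [← c.isHom_proj.2, (coind_unital h).2]⟩

theorem proj_emb (c : BiAction k E M) (m : M) : c.proj (c.emb m) = 0 :=
  (Submodule.Quotient.mk_eq_zero _).2 ⟨m, rfl⟩

theorem emb_of_proj_eq_zero {c : BiAction k E M} (h : c.Unital) {j : E →ₗ[k] M}
    (hj : c.proj j = 0) : c.emb (j 1) = j := by
  obtain ⟨m, rfl⟩ := (Submodule.Quotient.mk_eq_zero _).1 hj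
  simp [h.2]

/-- Evaluation at `1` is a `k`-linear retraction of the embedding, so `j ↦ j - emb (j 1)` descends
to a section. Lifting cochains to the coinduced bimodule thus needs no projectivity. -/
theorem exists_section {c : BiAction k E M} (h : c.Unital) :
    ∃ s : c.Coker →ₗ[k] E →ₗ[k] M, ∀ q, c.proj (s q) = q := by
  refine ⟨Submodule.liftQ _ (LinearMap.id - c.emb ∘ₗ LinearMap.applyₗ 1) ?_, fun q => ?_⟩
  · rintro _ ⟨m, rfl⟩
    ext
    simp [h.2]
  · obtain ⟨j, rfl⟩ := c.proj_surjective q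
    have := c.proj_emb (j 1)
    simp only [Submodule.mkQ_apply, Submodule.liftQ_apply] at this ⊢
    simp [this]

theorem post_proj_surjective {c : BiAction k E M} (h : c.Unital) (n : ℕ) :
    Function.Surjective (post (A := A) c.proj (n := n)) := by
  obtain ⟨s, hs⟩ := exists_section h
  exact fun f => ⟨post s f, by ext; simp only [post_apply, hs]⟩

theorem post_proj_emb (c : BiAction k E M) {n : ℕ} (f : Cochain k A M n) :
    post c.proj (post c.emb f) = 0 := by
  ext
  exact c.proj_emb _

theorem exists_post_emb {c : BiAction k E M} (h : c.Unital) {n : ℕ}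
    {f : Cochain k A (E →ₗ[k] M) n} (hf : post c.proj f = 0) : ∃ g, post c.emb g = f := by
  refine ⟨post (LinearMap.applyₗ 1) f, ?_⟩
  ext1 a
  exact emb_of_proj_eq_zero h (DFunLike.congr_fun hf a)

/-- A coinduced bimodule has no higher cohomology over a subalgebra over which `E` is a
projective left module relative to `k`. -/
theorem exists_D_eq_of_coind (c : BiAction k E M) (ι κ : A →ₐ[k] E) (Δ : E →ₗ[k] A ⊗[k] E)
    (h1 : ∀ a e, Δ (κ a * e) = (LinearMap.mulLeft k a).rTensor E (Δ e))
    (h2 : ∀ e, TensorProduct.lift (LinearMap.mul k E ∘ₗ κ.toLinearMap) (Δ e) = e) {n : ℕ}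
    (f : Cochain k A (E →ₗ[k] M) (n + 1)) (hf : (c.coind.pull ι κ).D (n + 1) f = 0) :
    ∃ g, (c.coind.pull ι κ).D n g = f := by
  -- If `Δ e = ∑ b ⊗ u`, then `ψ φ e = ∑ φ(b)(u)`. Left linearity of `Δ` and `∑ κ(b) u = e` make the
  -- defect of `ψ` the identity, so `ψ` gives a contracting homotopy up to sign.
  let ψ : (A →ₗ[k] E →ₗ[k] M) →ₗ[k] E →ₗ[k] M := LinearMap.lcomp k M Δ ∘ₗ
    (TensorProduct.lift.equiv (RingHom.id k) A E M).toLinearMap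
  have hψ : ∀ φ e, ψ φ e = TensorProduct.lift φ (Δ e) := fun _ _ => rfl
  have key := D_post_defect n (c.coind.pull ι κ).shift (c.coind.pull ι κ) ψ LinearMap.id
    (fun a φ => by
      ext e
      rw [hψ, pull_l, coind_l, hψ]
      induction Δ e using TensorProduct.induction_on with
      | zero => simp
      | add s t hs ht => rw [map_add, hs, ht, map_add, map_add]
      | tmul b e => simp)
    (fun a φ => by
      ext e
      rw [hψ, pull_r, LinearMap.sub_apply, coind_r, hψ, h1, LinearMap.id_apply]
      refine Eq.trans ?_ (congrArg (fun e' => TensorProduct.lift φ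
        ((LinearMap.mulLeft k a).rTensor E (Δ e)) - φ a e') (h2 e))
      induction Δ e using TensorProduct.induction_on with
      | zero => simp
      | add s t hs ht => simp only [map_add, hs, ht]; abel
      | tmul b e => simp)
    (cur k A (E →ₗ[k] M) n f)
  have h3 : post LinearMap.id (cur k A (E →ₗ[k] M) n f) = cur k A (E →ₗ[k] M) n f := rfl
  rw [← cur_D, hf, map_zero, map_zero, zero_add, h3, LinearEquiv.symm_apply_apply] at key
  refine ⟨(-1 : ℤ) ^ (n + 1) • post ψ (cur k A (E →ₗ[k] M) n f), ?_⟩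
  rw [map_zsmul, key, smul_smul, ← mul_pow]
  simp

end Coinduced

end BiAction

/-! ### Coordinates on the Ore extension and acyclicity over `A` -/

section Ore

variable {k : Type u} {A E : Type v} [CommRing k] [Ring A] [Algebra k A] [Ring E] [Algebra k E]
  {σ : A →ₐ[k] A} {δ : A →ₗ[k] A} {ι : A →ₐ[k] E} {x : E}

namespace IsOreExtension

/-- The coordinates with respect to the powers of `x`. -/
noncomputable def coord (hE : IsOreExtension σ δ ι x) : (ℕ →₀ A) ≃ₗ[k] E :=
  LinearEquiv.ofBijective
    (Finsupp.lsum k fun i => LinearMap.mulRight k (x ^ i) ∘ₗ ι.toLinearMap) hE.basis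

theorem coord_single (hE : IsOreExtension σ δ ι x) (i : ℕ) (a : A) :
    hE.coord (Finsupp.single i a) = ι a * x ^ i := by
  change Finsupp.lsum k (fun i => LinearMap.mulRight k (x ^ i) ∘ₗ ι.toLinearMap)
    (Finsupp.single i a) = _
  simp

variable {X : Type w} [AddCommGroup X] [Module k X]

/-- The linear map `∑ᵢ aᵢ xⁱ ↦ ∑ᵢ fᵢ(aᵢ)`. -/
noncomputable def lift (hE : IsOreExtension σ δ ι x) (f : ℕ → A →ₗ[k] X) : E →ₗ[k] X :=
  Finsupp.lsum k f ∘ₗ hE.coord.symm.toLinearMap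

@[simp] theorem lift_apply (hE : IsOreExtension σ δ ι x) (f : ℕ → A →ₗ[k] X) (i : ℕ) (a : A) :
    hE.lift f (ι a * x ^ i) = f i a := by
  simp [lift, ← hE.coord_single]

theorem hom_ext (hE : IsOreExtension σ δ ι x) {f g : E →ₗ[k] X}
    (h : ∀ i a, f (ι a * x ^ i) = g (ι a * x ^ i)) : f = g := by
  have : f ∘ₗ hE.coord.toLinearMap = g ∘ₗ hE.coord.toLinearMap :=
    Finsupp.lhom_ext fun i a => by simpa [hE.coord_single] using h i a
  ext e
  obtain ⟨p, rfl⟩ := hE.coord.surjective e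
  exact DFunLike.congr_fun this p

/-- The splitting `a xⁱ ↦ a ⊗ xⁱ` of the multiplication map. -/
noncomputable def split (hE : IsOreExtension σ δ ι x) : E →ₗ[k] A ⊗[k] E :=
  hE.lift fun i => (TensorProduct.mk k A E).flip (x ^ i)

theorem split_mul (hE : IsOreExtension σ δ ι x) (a : A) (e : E) :
    hE.split (ι a * e) = (LinearMap.mulLeft k a).rTensor E (hE.split e) := by
  refine DFunLike.congr_fun (f := hE.split ∘ₗ LinearMap.mulLeft k (ι a))
    (g := (LinearMap.mulLeft k a).rTensor E ∘ₗ hE.split) (hE.hom_ext fun i b => ?_) e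
  simp [split, ← mul_assoc, ← map_mul]

theorem mul_split (hE : IsOreExtension σ δ ι x) (e : E) :
    TensorProduct.lift (LinearMap.mul k E ∘ₗ ι.toLinearMap) (hE.split e) = e := by
  refine DFunLike.congr_fun (f := TensorProduct.lift (LinearMap.mul k E ∘ₗ ι.toLinearMap) ∘ₗ
    hE.split) (g := LinearMap.id) (hE.hom_ext fun i b => ?_) e
  simp [split]

end IsOreExtension

end Ore

section OreAcyclic

open BiAction

variable {k : Type u} {A E : Type v} [CommRing k] [Ring A] [Algebra k A] [Ring E] [Algebra k E]
  {M : Type v} [AddCommGroup M] [Module k M]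

theorem coind_acyclic (c : BiAction k E M) {n : ℕ} (f : Cochain k E (E →ₗ[k] M) (n + 1))
    (hf : c.coind.D (n + 1) f = 0) : ∃ g, c.coind.D n g = f :=
  exists_D_eq_of_coind c (AlgHom.id k E) (AlgHom.id k E) ((TensorProduct.mk k E E).flip 1)
    (by simp) (by simp) f hf

variable {σ : A ≃ₐ[k] A} {δ : A →ₗ[k] A} {ι : A →ₐ[k] E} {x : E}
  (hE : IsOreExtension (σ : A →ₐ[k] A) δ ι x)
include hE

theorem coind_pull_acyclic (c : BiAction k E M) {n : ℕ} (f : Cochain k A (E →ₗ[k] M) (n + 1))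
    (hf : (c.coind.pull ι ι).D (n + 1) f = 0) : ∃ g, (c.coind.pull ι ι).D n g = f :=
  exists_D_eq_of_coind c ι ι hE.split hE.split_mul hE.mul_split f hf

/-- Through `ι σ⁻¹` the basis of powers of `x` still works: the splitting becomes `a xⁱ ↦ σ(a) ⊗
xⁱ`. -/
theorem coind_twist_acyclic (c : BiAction k E M) {n : ℕ} (f : Cochain k A (E →ₗ[k] M) (n + 1))
    (hf : (c.coind.pull ι (ι.comp (σ.symm : A →ₐ[k] A))).D (n + 1) f = 0) :
    ∃ g, (c.coind.pull ι (ι.comp (σ.symm : A →ₐ[k] A))).D n g = f := by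
  refine exists_D_eq_of_coind c ι (ι.comp (σ.symm : A →ₐ[k] A))
    (σ.toLinearMap.rTensor E ∘ₗ hE.split) (fun a e => ?_) (fun e => ?_) f hf
  · have h := hE.split_mul (σ.symm a) e
    change σ.toLinearMap.rTensor E (hE.split (ι (σ.symm a) * e)) = _
    rw [h, LinearMap.comp_apply]
    induction hE.split e using TensorProduct.induction_on with
    | zero => simp
    | add s t hs ht => simp only [map_add, hs, ht]
    | tmul b e => simp
  · conv_rhs => rw [← hE.mul_split e]
    rw [LinearMap.comp_apply]
    induction hE.split e using TensorProduct.induction_on with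
    | zero => simp
    | add s t hs ht => simp only [map_add, hs, ht]
    | tmul b e => simp

/-- On the left linear maps from the Ore extension to a module, `j ↦ x j - j x` is onto. -/
theorem exists_thetaRec_eq_of_coind (c : BiAction k E M) (h : Cochain k A (E →ₗ[k] M) 0)
    (hh : (c.coind.pull ι (ι.comp (σ.symm : A →ₐ[k] A))).D 0 h = 0) :
    ∃ g, (c.coind.pull ι ι).D 0 g = 0 ∧
      thetaRec σ δ 0 (c.coind.l x) (c.coind.r x) LinearMap.id g = h := by
  have hh' : ∀ a e, c.l (ι a) (h Fin.elim0 e) = h Fin.elim0 (ι (σ.symm a) * e) := by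
    intro a e
    have := DFunLike.congr_fun (DFunLike.congr_fun hh fun _ => a) e
    have h0 : (fun i : Fin 0 => a) = Fin.elim0 := Subsingleton.elim _ _
    simp only [D_zero, cur_symm_apply, post_apply, h0] at this
    simpa [sub_eq_zero] using this
  -- A left `A`-linear `j` is determined by `t i = j(xⁱ)`. The equation `x j - j x = h` at `xⁱ`
  -- forces this recursion, and the start `t 0 = 0` is a free choice.
  let t : ℕ → M := fun n => Nat.rec 0 (fun i m => c.l x m - h Fin.elim0 (x ^ i)) n
  have ht : ∀ i, t (i + 1) = c.l x (t i) - h Fin.elim0 (x ^ i) := fun _ => rfl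
  let j : E →ₗ[k] M := hE.lift fun i => c.l.flip (t i) ∘ₗ ι.toLinearMap
  have hj : ∀ i a, j (ι a * x ^ i) = c.l (ι a) (t i) := fun i a => by simp [j]
  refine ⟨MultilinearMap.constOfIsEmpty k _ j, ?_, ?_⟩
  · ext a e
    simp only [D_zero, cur_symm_apply, post_apply, MultilinearMap.constOfIsEmpty_apply]
    have : c.l (ι (a (Fin.last 0))) ∘ₗ j = j ∘ₗ LinearMap.mulLeft k (ι (a (Fin.last 0))) :=
      hE.hom_ext fun i b => by
        simp only [LinearMap.comp_apply, hj, LinearMap.mulLeft_apply, ← mul_assoc, ← map_mul,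
          ← c.l_mul]
    simpa [sub_eq_zero] using DFunLike.congr_fun this e
  · ext1 a
    have ha : a = Fin.elim0 := Subsingleton.elim _ _
    rw [thetaRec, post_apply, MultilinearMap.constOfIsEmpty_apply, ha]
    change (c.coind.l x - c.coind.r x) j = _
    refine hE.hom_ext fun i b => ?_
    have h1 := hh' (σ b) (x ^ i)
    have h2 : x * (ι b * x ^ i) = ι (σ b) * x ^ (i + 1) + ι (δ b) * x ^ i := by
      have := hE.comm b
      simp at this
      rw [← mul_assoc, this, add_mul, mul_assoc, pow_succ']
    have h3 := hE.comm b
    simp at h3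
    simp only [LinearMap.sub_apply, coind_l, coind_r, h2, map_add, hj, ht, map_sub, ← c.l_mul, h3,
      h1, LinearMap.add_apply, AlgEquiv.symm_apply_apply]
    abel

end OreAcyclic

end OreHochschild

/-! ### The mapping cocone of `θ` computes the cohomology of `E` -/

namespace OreHochschild

open BiAction

section Cone

variable {k : Type u} {A E : Type v} [CommRing k] [Ring A] [Algebra k A] [Ring E] [Algebra k E]
  {M : Type v} [AddCommGroup M] [Module k M] {N : Type v} [AddCommGroup N] [Module k N]

variable (k A M) in
/-- The cochains of the mapping cocone of `θ`. -/
def Cone : ℕ → Type v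
  | 0 => Cochain k A M 0
  | n + 1 => Cochain k A M (n + 1) × Cochain k A M n

instance (n : ℕ) : AddCommGroup (Cone k A M n) :=
  match n with
  | 0 => inferInstanceAs (AddCommGroup (Cochain k A M 0))
  | n + 1 => inferInstanceAs (AddCommGroup (Cochain k A M (n + 1) × Cochain k A M n))

variable (A) in
/-- Composition with a linear map of coefficients. -/
def conePost (φ : M →ₗ[k] N) : (n : ℕ) → Cone k A M n →+ Cone k A N n
  | 0 => (post φ : Cochain k A M 0 →ₗ[k] Cochain k A N 0).toAddMonoidHom
  | n + 1 => AddMonoidHom.prodMap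
      (post φ : Cochain k A M (n + 1) →ₗ[k] Cochain k A N (n + 1)).toAddMonoidHom
      (post φ : Cochain k A M n →ₗ[k] Cochain k A N n).toAddMonoidHom

theorem conePost_injective {φ : M →ₗ[k] N} (hφ : Function.Injective φ) (n : ℕ) :
    Function.Injective (conePost A φ n) := by
  cases n with
  | zero => exact post_injective hφ 0
  | succ n => exact (post_injective hφ (n + 1)).prodMap (post_injective hφ n)

theorem conePost_proj_surjective {c : BiAction k E M} (h : c.Unital) (n : ℕ) :
    Function.Surjective (conePost A c.proj n) := by
  cases n with
  | zero => exact post_proj_surjective h 0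
  | succ n => exact (post_proj_surjective h (n + 1)).prodMap (post_proj_surjective h n)

theorem conePost_proj_emb (c : BiAction k E M) {n : ℕ} (w : Cone k A M n) :
    conePost A c.proj n (conePost A c.emb n w) = 0 := by
  cases n with
  | zero => exact post_proj_emb c w
  | succ n => exact Prod.ext (post_proj_emb c w.1) (post_proj_emb c w.2)

theorem exists_conePost_emb {c : BiAction k E M} (h : c.Unital) {n : ℕ}
    {w : Cone k A (E →ₗ[k] M) n} (hw : conePost A c.proj n w = 0) :
    ∃ w', conePost A c.emb n w' = w := by
  cases n with
  | zero => exact exists_post_emb h hw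
  | succ n =>
    obtain ⟨f, hf⟩ := exists_post_emb h (congrArg Prod.fst hw)
    obtain ⟨g, hg⟩ := exists_post_emb h (congrArg Prod.snd hw)
    exact ⟨(f, g), Prod.ext hf hg⟩

variable (σ : A ≃ₐ[k] A) (δ : A →ₗ[k] A) (ι : A →ₐ[k] E) (x : E)

/-- The cochains with values in an `E`-bimodule, with the map `θ`. -/
abbrev thetaE (c : BiAction k E M) (n : ℕ) : Cochain k A M n →ₗ[k] Cochain k A M n :=
  thetaRec σ δ n (c.l x) (c.r x) LinearMap.id

/-- The differential of the mapping cocone of `θ`. -/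
def coneD (c : BiAction k E M) : (n : ℕ) → Cone k A M n →+ Cone k A M (n + 1)
  | 0 => AddMonoidHom.prod ((c.pull ι ι).D 0).toAddMonoidHom (thetaE σ δ x c 0).toAddMonoidHom
  | n + 1 => AddMonoidHom.prod
      (((c.pull ι ι).D (n + 1)).toAddMonoidHom.comp (AddMonoidHom.fst _ _))
      ((thetaE σ δ x c (n + 1)).toAddMonoidHom.comp (AddMonoidHom.fst _ _) -
        ((c.pull ι (ι.comp (σ.symm : A →ₐ[k] A))).D n).toAddMonoidHom.comp (AddMonoidHom.snd _ _))

theorem coneD_succ (c : BiAction k E M) (n : ℕ) (f : Cochain k A M (n + 1))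
    (h : Cochain k A M n) : coneD σ δ ι x c (n + 1) (f, h) = ((c.pull ι ι).D (n + 1) f,
      thetaE σ δ x c (n + 1) f - (c.pull ι (ι.comp (σ.symm : A →ₐ[k] A))).D n h) := rfl

/-- The comparison map from the Hochschild cochains of the Ore extension. -/
def conePhi : (n : ℕ) → Cochain k E M n →+ Cone k A M n
  | 0 => (res ι : Cochain k E M 0 →ₗ[k] Cochain k A M 0).toAddMonoidHom
  | n + 1 => AddMonoidHom.prod
      (res ι : Cochain k E M (n + 1) →ₗ[k] Cochain k A M (n + 1)).toAddMonoidHom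
      (eta σ ι x n).toAddMonoidHom

theorem conePhi_succ (n : ℕ) (F : Cochain k E M (n + 1)) :
    conePhi σ ι x (n + 1) F = (res ι F, eta σ ι x n F) := rfl

theorem conePhi_post (n : ℕ) (φ : M →ₗ[k] N) (F : Cochain k E M n) :
    conePhi σ ι x n (post φ F) = conePost A φ n (conePhi σ ι x n F) := by
  cases n with
  | zero => rfl
  | succ n => exact Prod.ext rfl (eta_post σ ι x n φ F)

theorem thetaE_post {c : BiAction k E M} {c' : BiAction k E N} {φ : M →ₗ[k] N}
    (h : c.IsHom c' φ) {n : ℕ} (f : Cochain k A M n) :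
    thetaE σ δ x c' n (post φ f) = post φ (thetaE σ δ x c n f) := by
  have := thetaRec_post_defect σ δ n (c.l x) (c.r x) LinearMap.id (c'.l x) (c'.r x)
    LinearMap.id φ φ 0 (h.1 x) (by simp [h.2]) (by simp) f
  rw [thetaE, this]
  exact add_zero _

theorem coneD_post {c : BiAction k E M} {c' : BiAction k E N} {φ : M →ₗ[k] N}
    (h : c.IsHom c' φ) {n : ℕ} (w : Cone k A M n) :
    coneD σ δ ι x c' n (conePost A φ n w) = conePost A φ (n + 1) (coneD σ δ ι x c n w) := by
  cases n with
  | zero => exact Prod.ext (D_post (h.pull ι ι) w) (thetaE_post σ δ x h w)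
  | succ n =>
    refine Prod.ext (D_post (h.pull ι ι) w.1) ?_
    change thetaE σ δ x c' (n + 1) (post φ w.1) - (c'.pull _ _).D n (post φ w.2) =
      post φ (thetaE σ δ x c (n + 1) w.1 - (c.pull _ _).D n w.2)
    rw [thetaE_post σ δ x h, D_post (h.pull _ _), map_sub]

/-- Being a coboundary in the mapping cocone of `θ`. -/
def IsConeCob (c : BiAction k E M) : (n : ℕ) → Cone k A M n → Prop
  | 0, w => w = 0
  | n + 1, w => ∃ y, coneD σ δ ι x c n y = w

variable {σ δ ι x} (hE : IsOreExtension (σ : A →ₐ[k] A) δ ι x)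
  (hδ : IsSkewDerivation (σ : A →ₐ[k] A) δ)

include hE hδ in
theorem thetaE_D (c : BiAction k E M) {n : ℕ} (f : Cochain k A M n) :
    thetaE σ δ x c (n + 1) ((c.pull ι ι).D n f) =
      (c.pull ι (ι.comp (σ.symm : A →ₐ[k] A))).D n (thetaE σ δ x c n f) :=
  thetaRec_D hδ n (isSkew_of_ore hE.comm c) f

include hE hδ in
theorem coneD_coneD (c : BiAction k E M) {n : ℕ} (w : Cone k A M n) :
    coneD σ δ ι x c (n + 1) (coneD σ δ ι x c n w) = 0 := by
  cases n with
  | zero =>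
    exact Prod.ext (D_D 0 _ _) (sub_eq_zero.2 (thetaE_D hE hδ c (show Cochain k A M 0 from w)))
  | succ n =>
    obtain ⟨f, h⟩ := w
    rw [coneD_succ, coneD_succ, D_D, map_sub, D_D, thetaE_D hE hδ, sub_zero, sub_self]
    rfl

-- The second component is exactly the null homotopy formula `thetaRec_res`.
include hE in
theorem conePhi_D (c : BiAction k E M) {n : ℕ} (F : Cochain k E M n) :
    conePhi σ ι x (n + 1) (c.D n F) = coneD σ δ ι x c n (conePhi σ ι x n F) := by
  have h := thetaRec_res hE.comm n c F
  cases n with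
  | zero =>
    rw [etaBd, add_zero] at h
    exact Prod.ext (D_res ι 0 c F).symm h.symm
  | succ n => exact Prod.ext (D_res ι (n + 1) c F).symm (eq_sub_of_add_eq h.symm)

-- Acyclicity of the coinduced bimodule over `A`, plain and twisted, kills the two components in
-- turn.
include hE hδ in
theorem cone_acyclic (c : BiAction k E M) {n : ℕ} (w : Cone k A (E →ₗ[k] M) (n + 1))
    (hw : coneD σ δ ι x c.coind (n + 1) w = 0) : ∃ y, coneD σ δ ι x c.coind n y = w := by
  obtain ⟨f, h⟩ := w
  rw [coneD_succ] at hw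
  obtain ⟨g, rfl⟩ := coind_pull_acyclic hE c f (congrArg Prod.fst hw)
  have hh : (c.coind.pull ι (ι.comp (σ.symm : A →ₐ[k] A))).D n
      (thetaE σ δ x c.coind n g - h) = 0 := by
    rw [map_sub, ← thetaE_D hE hδ]
    exact congrArg Prod.snd hw
  cases n with
  | zero =>
    -- In lowest degree there is no second component to correct with; `g` is changed instead by a
    -- cocycle on which `θ` takes the required value.
    obtain ⟨g', hg', hg'h⟩ := exists_thetaRec_eq_of_coind hE c _ hh
    refine ⟨g - g', Prod.ext ?_ ?_⟩
    · change (c.coind.pull ι ι).D 0 (g - g') = _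
      rw [map_sub, hg', sub_zero]
    · change thetaE σ δ x c.coind 0 (g - g') = h
      have hg'' : thetaE σ δ x c.coind 0 g' = thetaE σ δ x c.coind 0 g - h := hg'h
      rw [map_sub, hg'', sub_sub_cancel]
  | succ n =>
    obtain ⟨g', hg'⟩ := coind_twist_acyclic hE c _ hh
    refine ⟨(g, g'), ?_⟩
    rw [coneD_succ, hg', sub_sub_cancel]

/-- The coinduced lift of a primitive has a differential that is automatically a cocycle. In degree
zero the only coboundary is `0`, which lifts to `0`, so the dimension shift needs no separate case.
-/
theorem exists_cocycle_post_eq {c : BiAction k E M} (hc : c.Unital) {n : ℕ}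
    {f : Cochain k E c.Coker n} (hf : c.coker.IsCob n f) :
    ∃ g, c.coind.D n g = 0 ∧ post c.proj g = f := by
  cases n with
  | zero => exact ⟨0, map_zero _, (map_zero _).trans hf.symm⟩
  | succ n =>
    obtain ⟨g, rfl⟩ := hf
    obtain ⟨g, rfl⟩ := post_proj_surjective hc n g
    exact ⟨c.coind.D n g, D_D n _ g, (D_post c.isHom_proj g).symm⟩

include hE hδ in
theorem exists_cone_cocycle_post_eq {c : BiAction k E M} (hc : c.Unital) {n : ℕ}
    {w : Cone k A c.Coker n} (hw : IsConeCob σ δ ι x c.coker n w) :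
    ∃ y, coneD σ δ ι x c.coind n y = 0 ∧ conePost A c.proj n y = w := by
  cases n with
  | zero => exact ⟨0, map_zero _, (map_zero _).trans hw.symm⟩
  | succ n =>
    obtain ⟨y, rfl⟩ := hw
    obtain ⟨y, rfl⟩ := conePost_proj_surjective hc n y
    exact ⟨coneD σ δ ι x c.coind n y, coneD_coneD hE hδ _ y, (coneD_post σ δ ι x c.isHom_proj y).symm⟩

-- An element commuting with `A` and with `x` commutes with every `a xⁱ`, hence with all of `E`.
include hE in
theorem conePhi_zero_surjective (c : BiAction k E M) (hc : c.Unital) (w : Cone k A M 0)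
    (hw : coneD σ δ ι x c 0 w = 0) : ∃ F, c.D 0 F = 0 ∧ conePhi σ ι x 0 F = w := by
  let w' : Cochain k A M 0 := w
  have h1 : (c.pull ι ι).D 0 w' = 0 := congrArg Prod.fst hw
  have h2 : thetaE σ δ x c 0 w' = 0 := congrArg Prod.snd hw
  have hl : ∀ a, c.l (ι a) (w' Fin.elim0) = c.r (ι a) (w' Fin.elim0) := fun a => by
    have h0 : (fun i : Fin 0 => a) = Fin.elim0 := Subsingleton.elim _ _
    have := DFunLike.congr_fun h1 fun _ => a
    simp only [D_zero, cur_symm_apply, post_apply, h0] at this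
    simpa [sub_eq_zero] using this
  have hx : c.l x (w' Fin.elim0) = c.r x (w' Fin.elim0) := by
    have := DFunLike.congr_fun h2 Fin.elim0
    simpa [thetaE, thetaRec, sub_eq_zero] using this
  have hpow : ∀ i, c.l (x ^ i) (w' Fin.elim0) = c.r (x ^ i) (w' Fin.elim0) := fun i => by
    induction i with
    | zero => rw [pow_zero, hc.1, hc.2]
    | succ i ih => rw [pow_succ', c.l_mul, ih, c.comm, hx, ← c.r_mul]
  have hall : c.l.flip (w' Fin.elim0) = c.r.flip (w' Fin.elim0) := hE.hom_ext fun i a => by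
    simp only [LinearMap.flip_apply]
    rw [c.l_mul, hpow, c.comm, hl, c.r_mul]
  refine ⟨MultilinearMap.constOfIsEmpty k _ (w' Fin.elim0), ?_, ?_⟩
  · ext a
    simp [D_zero, sub_eq_zero]
    exact DFunLike.congr_fun hall _
  · refine MultilinearMap.ext (f' := w') fun a => ?_
    rw [Subsingleton.elim a Fin.elim0]
    rfl

include hE hδ in
/-- The comparison map is a quasi-isomorphism. -/
theorem conePhi_quasiIso : ∀ (n : ℕ) {M : Type v} [AddCommGroup M] [Module k M]
    (c : BiAction k E M) (_ : c.Unital),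
    (∀ w, coneD σ δ ι x c n w = 0 →
      ∃ F, c.D n F = 0 ∧ IsConeCob σ δ ι x c n (w - conePhi σ ι x n F)) ∧
    ∀ F, c.D n F = 0 → IsConeCob σ δ ι x c n (conePhi σ ι x n F) → c.IsCob n F
  | 0, M, _, _, c, hc => by
    refine ⟨fun w hw => ?_, fun F _ hF => ?_⟩
    · obtain ⟨F, hF, rfl⟩ := conePhi_zero_surjective hE c hc w hw
      exact ⟨F, hF, sub_self _⟩
    · ext a
      have := DFunLike.congr_fun (show res ι F = 0 from hF) Fin.elim0
      rw [res_apply] at this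
      rw [Subsingleton.elim a fun i => ι (Fin.elim0 i), this]
      rfl
  | n + 1, M, _, _, c, hc => by
    refine ⟨fun w hw => ?_, fun F hF hΦ => ?_⟩
    -- Surjectivity in degree `n + 1`: pass to the cokernel through a coinduced primitive `u`, use
    -- surjectivity there in degree `n`, and pull the differential of the lifted `F` back to `M`.
    · obtain ⟨u, hu⟩ := cone_acyclic hE hδ c (conePost A c.emb (n + 1) w)
        (by rw [coneD_post σ δ ι x c.isHom_emb, hw, map_zero])
      obtain ⟨F', hF', hcob⟩ := (conePhi_quasiIso n c.coker (coker_unital hc)).1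
        (conePost A c.proj n u)
        (by rw [coneD_post σ δ ι x c.isHom_proj, hu, conePost_proj_emb])
      obtain ⟨F, rfl⟩ := post_proj_surjective hc n F'
      obtain ⟨y, hy, hyu⟩ := exists_cone_cocycle_post_eq hE hδ hc hcob
      obtain ⟨m, hm⟩ := exists_conePost_emb hc (w := u - conePhi σ ι x n F - y)
        (by rw [map_sub, map_sub, hyu, conePhi_post, sub_self])
      obtain ⟨G, hG⟩ := exists_post_emb hc (f := c.coind.D n F)
        (by rw [← D_post c.isHom_proj, hF'])
      refine ⟨G, post_injective (emb_injective hc) _ ?_, m,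
        conePost_injective (emb_injective hc) _ ?_⟩
      · rw [← D_post c.isHom_emb, hG, D_D, map_zero]
      · rw [← coneD_post σ δ ι x c.isHom_emb, hm, map_sub, map_sub, map_sub, hu, hy, sub_zero,
          ← conePhi_D hE, ← hG, conePhi_post]
    · obtain ⟨m, hm⟩ := hΦ
      obtain ⟨G, hG⟩ := coind_acyclic c (post c.emb F) (by rw [D_post c.isHom_emb, hF, map_zero])
      -- The two primitives, of `F` over `E` and of its image in the cocone, differ by a cocycle
      -- over the coinduced bimodule. Surjectivity in degree `n` removes it by `H`, so that
      -- injectivity for the cokernel applies to `G - H`.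
      obtain ⟨H, hH, hcob⟩ := (conePhi_quasiIso n c.coind (coind_unital hc)).1
        (conePhi σ ι x n G - conePost A c.emb n m)
        (by rw [map_sub, ← conePhi_D hE, hG, conePhi_post, ← hm, coneD_post σ δ ι x c.isHom_emb,
          sub_self])
      have hcob' : IsConeCob σ δ ι x c.coker n (conePhi σ ι x n (post c.proj (G - H))) := by
        have h1 : conePhi σ ι x n (post c.proj (G - H)) = conePost A c.proj n
            (conePhi σ ι x n G - conePost A c.emb n m - conePhi σ ι x n H) := by
          rw [conePhi_post, map_sub, map_sub, map_sub, map_sub, conePost_proj_emb, sub_zero]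
        rw [h1]
        cases n with
        | zero => exact (congrArg _ hcob).trans (map_zero _)
        | succ n =>
          obtain ⟨y, hy⟩ := hcob
          exact ⟨conePost A c.proj n y, by rw [coneD_post σ δ ι x c.isHom_proj, hy]⟩
      obtain ⟨y, hy, hyG⟩ := exists_cocycle_post_eq hc
        ((conePhi_quasiIso n c.coker (coker_unital hc)).2 (post c.proj (G - H))
          (by rw [D_post c.isHom_proj, map_sub, hH, hG, sub_zero, post_proj_emb]) hcob')
      obtain ⟨m', hm'⟩ := exists_post_emb hc (f := G - H - y)
        (by rw [map_sub, hyG, sub_self])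
      refine ⟨m', post_injective (emb_injective hc) _ ?_⟩
      rw [← D_post c.isHom_emb, hm', map_sub, map_sub, hH, hy, hG, sub_zero, sub_zero]

end Cone

end OreHochschild

/-! ### Universal cocycles and the finiteness hypothesis -/

namespace OreHochschild

namespace BiAction

variable {k : Type u} {A : Type v} [CommRing k] [Ring A] [Algebra k A]
  {M : Type v} [AddCommGroup M] [Module k M] {N : Type v} [AddCommGroup N] [Module k N]

/-- A unital bimodule as a module over the enveloping algebra. -/
noncomputable def toEnv (c : BiAction k A M) (h : c.Unital) : Env k A →ₐ[k] Module.End k M :=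
  Algebra.TensorProduct.lift
    (AlgHom.ofLinearMap (B := Module.End k M) c.l (LinearMap.ext h.1)
      fun a b => LinearMap.ext (c.l_mul a b))
    (AlgHom.ofLinearMap (B := Module.End k M)
      (c.r ∘ₗ (MulOpposite.opLinearEquiv k).symm.toLinearMap) (LinearMap.ext h.2)
      fun a b => LinearMap.ext (c.r_mul b.unop a.unop))
    fun a b => LinearMap.ext (c.comm a b.unop)

theorem toEnv_tmul (c : BiAction k A M) (h : c.Unital) (a : A) (b : Aᵐᵒᵖ) (m : M) :
    c.toEnv h (a ⊗ₜ b) m = c.l a (c.r b.unop m) := rfl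

theorem IsHom.map_toEnv {c : BiAction k A M} {c' : BiAction k A N} {φ : M →ₗ[k] N}
    (hφ : c.IsHom c' φ) (h : c.Unital) (h' : c'.Unital) (e : Env k A) (m : M) :
    φ (c.toEnv h e m) = c'.toEnv h' e (φ m) := by
  induction e using TensorProduct.induction_on with
  | zero => simp
  | add s t hs ht => simp only [map_add, LinearMap.add_apply, hs, ht]
  | tmul a b => simp only [toEnv_tmul, hφ.1, hφ.2]

section OfEnv

variable [Module (Env k A) M] [IsScalarTower k (Env k A) M]
  [Module (Env k A) N] [IsScalarTower k (Env k A) N]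

variable (k A M) in
/-- A module over the enveloping algebra as a bimodule. -/
def ofEnv : BiAction k A M where
  l := LinearMap.mk₂ k (fun a m => (a ⊗ₜ[k] (1 : Aᵐᵒᵖ)) • m)
    (by simp [TensorProduct.add_tmul, add_smul])
    (fun r a m => by rw [← TensorProduct.smul_tmul', smul_assoc]) (by simp)
    (fun r a m => by rw [smul_algebra_smul_comm])
  r := LinearMap.mk₂ k (fun a m => ((1 : A) ⊗ₜ[k] MulOpposite.op a) • m)
    (by simp [TensorProduct.tmul_add, add_smul])
    (fun r a m => by rw [MulOpposite.op_smul, TensorProduct.tmul_smul, smul_assoc]) (by simp)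
    (fun r a m => by rw [smul_algebra_smul_comm])
  l_mul a b m := by simp [smul_smul]
  r_mul a b m := by simp [smul_smul]
  comm a b m := by simp [smul_smul]

theorem ofEnv_l (a : A) (m : M) : (ofEnv k A M).l a m = (a ⊗ₜ[k] (1 : Aᵐᵒᵖ)) • m := rfl

theorem ofEnv_r (a : A) (m : M) :
    (ofEnv k A M).r a m = ((1 : A) ⊗ₜ[k] MulOpposite.op a) • m := rfl

theorem ofEnv_unital : (ofEnv k A M).Unital :=
  ⟨fun m => by rw [ofEnv_l, ← Algebra.TensorProduct.one_def, one_smul],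
    fun m => by rw [ofEnv_r, MulOpposite.op_one, ← Algebra.TensorProduct.one_def, one_smul]⟩

theorem toEnv_ofEnv (e : Env k A) (m : M) : (ofEnv k A M).toEnv ofEnv_unital e m = e • m := by
  induction e using TensorProduct.induction_on with
  | zero => rw [map_zero]; exact (zero_smul (Env k A) m).symm
  | add s t hs ht => simp only [map_add, LinearMap.add_apply, hs, ht, add_smul]
  | tmul a b => rw [toEnv_tmul, ofEnv_l, ofEnv_r, smul_smul]; simp

theorem isHom_ofEnv (φ : M →ₗ[Env k A] N) :
    (ofEnv k A M).IsHom (ofEnv k A N) (φ.restrictScalars k) :=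
  ⟨fun _ _ => map_smul φ _ _, fun _ _ => map_smul φ _ _⟩

/-- Lifting of bimodule homomorphisms out of a projective bimodule. -/
theorem exists_lift [Module.Projective (Env k A) M] {J Q : Type v} [AddCommGroup J] [Module k J]
    [AddCommGroup Q] [Module k Q] {c : BiAction k A J} {c' : BiAction k A Q} (h : c.Unital)
    (h' : c'.Unital) {p : J →ₗ[k] Q} (hp : c.IsHom c' p) (hsurj : Function.Surjective p)
    {g : M →ₗ[k] Q} (hg : (ofEnv k A M).IsHom c' g) :
    ∃ G : M →ₗ[k] J, (ofEnv k A M).IsHom c G ∧ ∀ m, p (G m) = g m := by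
  let _ : Module (Env k A) J := Module.compHom J (c.toEnv h).toRingHom
  let _ : Module (Env k A) Q := Module.compHom Q (c'.toEnv h').toRingHom
  let p' : J →ₗ[Env k A] Q :=
    { toFun := p, map_add' := map_add p, map_smul' := fun e j => hp.map_toEnv h h' e j }
  let g' : M →ₗ[Env k A] Q :=
    { toFun := g
      map_add' := map_add g
      map_smul' := fun e m => by
        rw [← toEnv_ofEnv]
        exact hg.map_toEnv ofEnv_unital h' e m }
  obtain ⟨G, hG⟩ := Module.projective_lifting_property p' g' hsurj
  have hl : ∀ a j, c.l a j = (a ⊗ₜ[k] (1 : Aᵐᵒᵖ)) • j := fun a j =>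
    congrArg (c.l a) (h.2 j).symm
  have hr : ∀ a j, c.r a j = ((1 : A) ⊗ₜ[k] MulOpposite.op a) • j := fun a j => (h.1 _).symm
  refine ⟨{ toFun := G, map_add' := map_add G, map_smul' := fun r m => ?_ },
    ⟨fun a m => ?_, fun a m => ?_⟩, fun m => DFunLike.congr_fun hG m⟩
  · have h1 : r • m = algebraMap k (Env k A) r • m := (algebraMap_smul _ r m).symm
    rw [h1, map_smul]
    exact DFunLike.congr_fun ((c.toEnv h).commutes r) (G m)
  · exact (map_smul G _ _).trans (hl _ _).symm
  · exact (map_smul G _ _).trans (hr _ _).symm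

end OfEnv

/-- A cocycle from which, up to coboundaries, all cocycles in unital bimodules are obtained by
bimodule homomorphisms. -/
def IsUniversal (c : BiAction k A M) (n : ℕ) (z : Cochain k A M n) : Prop :=
  c.D n z = 0 ∧ ∀ {N : Type v} [AddCommGroup N] [Module k N] (c' : BiAction k A N), c'.Unital →
    ∀ f, c'.D n f = 0 → ∃ g : M →ₗ[k] N, c.IsHom c' g ∧ c'.IsCob n (f - post g z)

/-- Projectivity of `A` over `k` lifts one variable at a time: it makes `Hom(A, M) → Hom(A, N)`
surjective, and the induction proceeds with these coefficients. -/
theorem exists_post_eq [Module.Projective k A] : ∀ (n : ℕ) {M N : Type v} [AddCommGroup M]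
    [Module k M] [AddCommGroup N] [Module k N] (π : M →ₗ[k] N) (_ : Function.Surjective π)
    (z : Cochain k A N n), ∃ w, post π w = z
  | 0, M, N, _, _, _, _, π, hπ, z => by
    obtain ⟨m, hm⟩ := hπ (z Fin.elim0)
    refine ⟨MultilinearMap.constOfIsEmpty k _ m, MultilinearMap.ext fun a => ?_⟩
    rw [Subsingleton.elim a Fin.elim0]
    exact hm
  | n + 1, M, N, _, _, _, _, π, hπ, z => by
    obtain ⟨w, hw⟩ := exists_post_eq n (π.compRight k (M := A))
      (fun j => Module.projective_lifting_property π j hπ) (cur k A N n z)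
    refine ⟨(cur k A M n).symm w, ?_⟩
    rw [← cur_symm_post, hw, LinearEquiv.symm_apply_apply]

/-- Dimension shifting along a projective cover of the module of a universal cocycle. -/
theorem IsUniversal.succ [Module.Projective k A] {c : BiAction k A M} {n : ℕ}
    {z : Cochain k A M n} (hz : c.IsUniversal n z) {P : Type v} [AddCommGroup P] [Module k P]
    [Module (Env k A) P] [IsScalarTower k (Env k A) P] [Module.Projective (Env k A) P]
    {π : P →ₗ[k] M} (hπ : (ofEnv k A P).IsHom c π) (hsurj : Function.Surjective π)
    {cN : BiAction k A N} {i : N →ₗ[k] P} (hi : cN.IsHom (ofEnv k A P) i)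
    (hinj : Function.Injective i) (hex : LinearMap.ker π = LinearMap.range i) :
    ∃ z', cN.IsUniversal (n + 1) z' := by
  obtain ⟨w, hw⟩ := exists_post_eq n π hsurj z
  have hrange : ∀ a, (ofEnv k A P).D n w a ∈ LinearMap.range i := fun a => by
    rw [← hex, LinearMap.mem_ker, ← post_apply, ← D_post hπ, hw, hz.1]
    rfl
  -- The lift `w` of `z` need not be a cocycle; its differential takes values in the kernel of `π`,
  -- and this is the next universal cocycle.
  let z' : Cochain k A N (n + 1) := post (LinearEquiv.ofInjective i hinj).symm.toLinearMap
    (((ofEnv k A P).D n w).codRestrict _ hrange)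
  have hz' : post i z' = (ofEnv k A P).D n w := by
    ext a
    simp [z']
  refine ⟨z', post_injective hinj _ ?_, ?_⟩
  · rw [← D_post hi, hz', D_D, map_zero]
  intro L _ _ c' hc' f hf
  obtain ⟨j, hj⟩ := coind_acyclic c' (post c'.emb f) (by rw [D_post c'.isHom_emb, hf, map_zero])
  obtain ⟨g', hg', hcob⟩ := hz.2 c'.coker (coker_unital hc') (post c'.proj j)
    (by rw [D_post c'.isHom_proj, hj, post_proj_emb])
  obtain ⟨y, hy, hyj⟩ := exists_cocycle_post_eq hc' hcob
  obtain ⟨G, hG, hGg⟩ := exists_lift (coind_unital hc') (coker_unital hc') c'.isHom_proj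
    c'.proj_surjective (g := g' ∘ₗ π)
    ⟨fun a m => by simp [hπ.1, hg'.1], fun a m => by simp [hπ.2, hg'.2]⟩
  obtain ⟨m, hm⟩ := exists_post_emb hc' (f := j - post G w - y) (by
    rw [map_sub, map_sub, hyj, ← hw]
    ext a
    simp only [sub_apply, post_apply, hGg]
    simp)
  -- Since `π ∘ i = 0`, the map `G ∘ i` dies in the cokernel and so takes values in the embedded
  -- copy of `L`. Evaluation at `1` then recovers the bimodule map into `L`.
  have hGi : ∀ t, c'.emb (G (i t) 1) = G (i t) := fun t => emb_of_proj_eq_zero hc' (by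
    have : π (i t) = 0 := by
      rw [← LinearMap.mem_ker, hex]
      exact ⟨t, rfl⟩
    rw [hGg, LinearMap.comp_apply, this, map_zero])
  refine ⟨LinearMap.applyₗ 1 ∘ₗ G ∘ₗ i, ⟨fun a t => emb_injective hc' ?_,
    fun a t => emb_injective hc' ?_⟩, m, post_injective (emb_injective hc') _ ?_⟩
  · change c'.emb (G (i (cN.l a t)) 1) = c'.emb (c'.l a (G (i t) 1))
    rw [hGi, c'.isHom_emb.1, hGi, hi.1, hG.1]
  · change c'.emb (G (i (cN.r a t)) 1) = c'.emb (c'.r a (G (i t) 1))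
    rw [hGi, c'.isHom_emb.2, hGi, hi.2, hG.2]
  · have h1 : post c'.emb (post (LinearMap.applyₗ 1 ∘ₗ G ∘ₗ i) z') = post G (post i z') := by
      ext1 a
      exact hGi _
    rw [← D_post c'.isHom_emb, hm, map_sub, map_sub, hj, hy, sub_zero, D_post hG, map_sub, h1, hz']

/-- The unit is a universal cocycle in degree zero. -/
theorem isUniversal_one {c : BiAction k A A} (hl : ∀ a m, c.l a m = a * m)
    (hr : ∀ a m, c.r a m = m * a) :
    c.IsUniversal 0 (MultilinearMap.constOfIsEmpty k _ 1) := by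
  refine ⟨?_, fun {N} _ _ c' hc' f hf => ?_⟩
  · ext a
    simp [D_zero, hl, hr]
  · have h : ∀ a, c'.l a (f Fin.elim0) = c'.r a (f Fin.elim0) := fun a => by
      have h0 : (fun i : Fin 0 => a) = Fin.elim0 := Subsingleton.elim _ _
      have := DFunLike.congr_fun hf fun _ => a
      simp only [D_zero, cur_symm_apply, post_apply, h0] at this
      simpa [sub_eq_zero] using this
    refine ⟨c'.l.flip (f Fin.elim0), ⟨fun a m => ?_, fun a m => ?_⟩, ?_⟩
    · simp [hl, c'.l_mul]
    · simp only [hr, LinearMap.flip_apply]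
      rw [c'.l_mul, h, c'.comm]
    · ext a
      rw [Subsingleton.elim a Fin.elim0]
      simp [hc'.1]

/-- Dimension shifting starts from the unit of `A` in degree zero and runs along the syzygies, each
the kernel of a projective mapping onto the previous one. -/
theorem exists_isUniversal_range [Module.Projective k A] [Module (Env k A) A]
    [IsScalarTower k (Env k A) A]
    (hA : ∀ (a b m : A), (a ⊗ₜ[k] MulOpposite.op b : Env k A) • m = a * m * b)
    (P : ℕ → Type v) [∀ n, AddCommGroup (P n)] [∀ n, Module k (P n)] [∀ n, Module (Env k A) (P n)]
    [∀ n, IsScalarTower k (Env k A) (P n)] [∀ n, Module.Projective (Env k A) (P n)]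
    (ε : P 0 →ₗ[Env k A] A) (hε : Function.Surjective ε) (d : ∀ n, P (n + 1) →ₗ[Env k A] P n)
    (h0 : LinearMap.range (d 0) = LinearMap.ker ε)
    (hd : ∀ n, LinearMap.range (d (n + 1)) = LinearMap.ker (d n)) :
    ∀ n, ∃ z, (ofEnv k A (LinearMap.range (d n))).IsUniversal (n + 1) z
  | 0 => by
    refine IsUniversal.succ (c := ofEnv k A A) (π := ε.restrictScalars k)
      (i := (LinearMap.range (d 0)).subtype.restrictScalars k)
      (isUniversal_one (fun a m => ?_) fun a m => ?_) (isHom_ofEnv ε) hε (isHom_ofEnv _)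
      (LinearMap.range (d 0)).injective_subtype ?_
    · rw [ofEnv_l, ← MulOpposite.op_one, hA, mul_one]
    · rw [ofEnv_r, hA, one_mul]
    · ext p
      have := congrArg (fun S => p ∈ S) h0
      simpa using this.symm
  | n + 1 => by
    obtain ⟨z, hz⟩ := exists_isUniversal_range hA P ε hε d h0 hd n
    refine hz.succ (π := (d n).rangeRestrict.restrictScalars k)
      (i := (LinearMap.range (d (n + 1))).subtype.restrictScalars k)
      (isHom_ofEnv _) (d n).surjective_rangeRestrict (isHom_ofEnv _)
      (LinearMap.range (d (n + 1))).injective_subtype ?_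
    ext p
    have := congrArg (fun S => p ∈ S) (hd n)
    simpa [Subtype.ext_iff] using this.symm

/-- Universal cocycles with values in finitely generated bimodules. -/
theorem exists_finite_isUniversal [Module.Projective k A] (hres : HasFGProjectiveResolution k A)
    (n : ℕ) : ∃ (K : Type v) (_ : AddCommGroup K) (_ : Module k K) (_ : Module (Env k A) K)
      (_ : IsScalarTower k (Env k A) K) (z : Cochain k A K n), Module.Finite (Env k A) K ∧
      (ofEnv k A K).IsUniversal n z := by
  let _ : Module (Env k A) A := TensorProduct.Algebra.module
  have hA : ∀ (a b m : A), (a ⊗ₜ[k] MulOpposite.op b : Env k A) • m = a * m * b := fun a b m => by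
    rw [TensorProduct.Algebra.smul_def]
    simp [mul_assoc]
  have : IsScalarTower k (Env k A) A := ⟨fun r e m =>
    DFunLike.congr_fun (map_smul (TensorProduct.Algebra.moduleAux (R := k) (A := A) (B := Aᵐᵒᵖ)
      (M := A)) r e) m⟩
  obtain ⟨P, hP⟩ := hres
  let _ : ∀ n, Module k (P.complex.X n) := fun n => Module.compHom _ (algebraMap k (Env k A))
  have : ∀ n, IsScalarTower k (Env k A) (P.complex.X n) := fun n =>
    ⟨fun r e m => (congrArg (· • m) (Algebra.smul_def r e)).trans (mul_smul _ e m)⟩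
  have : ∀ n, Module.Projective (Env k A) (P.complex.X n) := fun n =>
    (IsProjective.iff_projective _).2 (P.projective n)
  let ε : P.complex.X 0 →ₗ[Env k A] A := (P.π.f 0).hom
  have hε : Function.Surjective ε := (ModuleCat.epi_iff_surjective (P.π.f 0)).1 inferInstance
  cases n with
  | zero =>
    exact ⟨A, inferInstance, inferInstance, inferInstance, inferInstance, _,
      Module.Finite.of_surjective ε hε, isUniversal_one
        (fun a m => by rw [ofEnv_l, ← MulOpposite.op_one, hA, mul_one])
        (fun a m => by rw [ofEnv_r, hA, one_mul])⟩
  | succ n =>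
    obtain ⟨z, hz⟩ := exists_isUniversal_range hA (fun n => P.complex.X n) ε hε
      (fun n => (P.complex.d (n + 1) n).hom) P.exact₀.moduleCat_range_eq_ker
      (fun n => (P.exact_succ n).moduleCat_range_eq_ker) n
    exact ⟨_, inferInstance, inferInstance, inferInstance, inferInstance, z, inferInstance, hz⟩

/-- If `A` has a resolution by finitely generated projective bimodules, then every cohomology
class with values in a directed union comes from one of its terms. -/
theorem exists_isCob_sub_of_directed [Module.Projective k A]
    (hres : HasFGProjectiveResolution k A) {c : BiAction k A M} (hc : c.Unital)
    (F : ℕ → Submodule k M) (hF : Monotone F) (hl : ∀ i a, ∀ m ∈ F i, c.l a m ∈ F i)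
    (hr : ∀ i a, ∀ m ∈ F i, c.r a m ∈ F i) (htop : ∀ m, ∃ i, m ∈ F i) {n : ℕ}
    {f : Cochain k A M n} (hf : c.D n f = 0) :
    ∃ i g, (∀ a, g a ∈ F i) ∧ c.D n g = 0 ∧ c.IsCob n (f - g) := by
  obtain ⟨K, _, _, _, _, z, ⟨s, hs⟩, hz⟩ := exists_finite_isUniversal hres n
  obtain ⟨g, hg, hcob⟩ := hz.2 c hc f hf
  choose N hN using htop
  -- The preimage of one filtration step is a sub-bimodule, and the supremum is chosen so that it
  -- contains the finitely many generators.
  let S : Submodule (Env k A) K :=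
    { carrier := {t | g t ∈ F (s.sup fun t => N (g t))}
      zero_mem' := by simp
      add_mem' := fun {a b} ha hb => by
        simp only [Set.mem_ofPred_eq, map_add] at *
        exact add_mem ha hb
      smul_mem' := fun e t ht => by
        simp only [Set.mem_ofPred_eq] at *
        rw [← toEnv_ofEnv, hg.map_toEnv ofEnv_unital hc]
        induction e using TensorProduct.induction_on with
        | zero => simp
        | add s t hs ht => rw [map_add]; exact add_mem hs ht
        | tmul a b => exact hl _ _ _ (hr _ _ _ ht) }
  have hS : S = ⊤ := by
    rw [← top_le_iff, ← hs, Submodule.span_le]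
    exact fun t ht => hF (Finset.le_sup (f := fun t => N (g t)) ht) (hN _)
  refine ⟨s.sup fun t => N (g t), post g z, fun a => ?_, ?_, hcob⟩
  · have : z a ∈ S := hS ▸ Submodule.mem_top
    exact this
  · rw [D_post hg, hz.1, map_zero]

end BiAction

end OreHochschild

/-! ### The degree filtration on `E ⊗ E` and injectivity of `θ` -/

namespace OreHochschild

open BiAction

section Filtration

variable {k : Type u} {A E : Type v} [CommRing k] [Ring A] [Algebra k A] [Ring E] [Algebra k E]

namespace TensorSquare

/-- A linear endomorphism acting on the first factor. -/
noncomputable def mapLeft : Module.End k E →ₗ[k] Module.End k (TensorSquare k E) :=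
  LinearMap.rTensorHom E

theorem mapLeft_tmul (T : Module.End k E) (m n : E) :
    mapLeft T (m ⊗ₜ[k] n : E ⊗[k] E) = (T m ⊗ₜ[k] n : E ⊗[k] E) := rfl

theorem mapLeft_mapLeft (S T : Module.End k E) (t : TensorSquare k E) :
    mapLeft S (mapLeft T t) = mapLeft (S * T) t := (LinearMap.rTensor_comp_apply E S T t).symm

theorem outer_l (e : E) :
    (outerStr k E).toBi.l e = mapLeft (LinearMap.mulLeft k e) := by
  refine TensorProduct.ext' fun m n => ?_
  exact (outerAction_tmul e 1 m n).trans (by rw [MulOpposite.unop_one, mul_one]; rfl)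

theorem outer_r_mapLeft (T : Module.End k E) (e : E) (t : TensorSquare k E) :
    mapLeft T ((outerStr k E).toBi.r e t) = (outerStr k E).toBi.r e (mapLeft T t) := by
  have h : ∀ m n : E, (outerStr k E).toBi.r e (m ⊗ₜ[k] n : E ⊗[k] E) =
      (m ⊗ₜ[k] (n * e) : E ⊗[k] E) := fun m n =>
    (outerAction_tmul 1 (MulOpposite.op e) m n).trans (by rw [one_mul]; rfl)
  refine DFunLike.congr_fun (f := mapLeft T ∘ₗ (outerStr k E).toBi.r e)
    (g := (outerStr k E).toBi.r e ∘ₗ mapLeft T) (TensorProduct.ext' fun m n => ?_) t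
  exact (congrArg (mapLeft T) (h m n)).trans (h (T m) n).symm

theorem outer_unital : (outerStr k E).toBi.Unital :=
  ⟨fun t => DFunLike.congr_fun (map_one (outerStr k E)) t,
    fun t => DFunLike.congr_fun (map_one (outerStr k E)) t⟩

end TensorSquare

namespace IsOreExtension

variable {σ : A ≃ₐ[k] A} {δ : A →ₗ[k] A} {ι : A →ₐ[k] E} {x : E}
  (hE : IsOreExtension (σ : A →ₐ[k] A) δ ι x)

/-- Truncation to degrees less than `N`. -/
noncomputable def trunc (N : ℕ) : Module.End k E :=
  hE.lift fun i => if i < N then LinearMap.mulRight k (x ^ i) ∘ₗ ι.toLinearMap else 0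

/-- The part of degree `N`. -/
noncomputable def top (N : ℕ) : Module.End k E :=
  hE.lift fun i => if i = N then LinearMap.mulRight k (x ^ i) ∘ₗ ι.toLinearMap else 0

/-- The map sending `∑ᵢ aᵢ xⁱ` to `σ⁻¹(a_{N+1}) x^N`. -/
noncomputable def lower (N : ℕ) : Module.End k E :=
  hE.lift fun i => if i = N + 1 then
    LinearMap.mulRight k (x ^ N) ∘ₗ ι.toLinearMap ∘ₗ σ.symm.toLinearMap else 0

theorem trunc_apply (N i : ℕ) (a : A) :
    hE.trunc N (ι a * x ^ i) = if i < N then ι a * x ^ i else 0 := by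
  rw [trunc, lift_apply]
  split_ifs <;> simp

theorem top_apply (N i : ℕ) (a : A) :
    hE.top N (ι a * x ^ i) = if i = N then ι a * x ^ i else 0 := by
  rw [top, lift_apply]
  split_ifs <;> simp

theorem lower_apply (N i : ℕ) (a : A) :
    hE.lower N (ι a * x ^ i) = if i = N + 1 then ι (σ.symm a) * x ^ N else 0 := by
  rw [lower, lift_apply]
  split_ifs <;> simp

theorem trunc_mulLeft (N : ℕ) (a : A) : hE.trunc N * LinearMap.mulLeft k (ι a) =
    LinearMap.mulLeft k (ι a) * hE.trunc N := hE.hom_ext fun i b => by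
  simp only [Module.End.mul_apply, LinearMap.mulLeft_apply, ← mul_assoc, ← map_mul, trunc_apply]
  split_ifs <;> simp [mul_assoc]

theorem lower_mulLeft (N : ℕ) (a : A) : hE.lower N * LinearMap.mulLeft k (ι (σ a)) =
    LinearMap.mulLeft k (ι a) * hE.lower N := hE.hom_ext fun i b => by
  simp only [Module.End.mul_apply, LinearMap.mulLeft_apply, ← mul_assoc, ← map_mul, lower_apply]
  split_ifs <;> simp [mul_assoc]

theorem trunc_zero : hE.trunc 0 = 0 := hE.hom_ext fun i b => by simp [trunc_apply]

theorem trunc_mul_trunc {N N' : ℕ} (h : N ≤ N') : hE.trunc N' * hE.trunc N = hE.trunc N :=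
  hE.hom_ext fun i b => by
    rw [Module.End.mul_apply, trunc_apply]
    split_ifs with hi
    · rw [trunc_apply, if_pos (hi.trans_le h)]
    · rw [map_zero]

theorem trunc_add_top (N : ℕ) : hE.trunc N + hE.top N = hE.trunc (N + 1) :=
  hE.hom_ext fun i b => by
    rw [LinearMap.add_apply, trunc_apply, trunc_apply, top_apply]
    split_ifs <;> first | omega | simp

/-- In degrees at most `N`, left multiplication by `x` reaches degree `N + 1` only through `a x^N ↦
σ(a) x^(N+1)`, and `lower` undoes this. -/
theorem lower_mulLeft_trunc (N : ℕ) :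
    hE.lower N * LinearMap.mulLeft k x * hE.trunc (N + 1) = hE.top N * hE.trunc (N + 1) :=
  hE.hom_ext fun i b => by
    simp only [Module.End.mul_apply, trunc_apply, LinearMap.mulLeft_apply]
    split_ifs with h
    · have h1 : x * (ι b * x ^ i) = ι (σ b) * x ^ (i + 1) + ι (δ b) * x ^ i := by
        have := hE.comm b
        simp at this
        rw [← mul_assoc, this, add_mul, mul_assoc, pow_succ']
      rw [h1, map_add, lower_apply, lower_apply, top_apply, if_neg (by omega : i ≠ N + 1)]
      by_cases hi : i = N <;> simp [hi]
    · simp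

theorem lower_trunc (N : ℕ) : hE.lower N * hE.trunc (N + 1) = 0 :=
  hE.hom_ext fun i b => by
    simp only [Module.End.mul_apply, trunc_apply]
    split_ifs with h
    · rw [lower_apply, if_neg (by omega)]; rfl
    · simp

theorem exists_trunc_eq (e : E) : ∃ N, hE.trunc N e = e := by
  obtain ⟨p, rfl⟩ := hE.coord.surjective e
  induction p using Finsupp.induction_linear with
  | zero => exact ⟨0, by simp⟩
  | add p q hp hq =>
    obtain ⟨N, hN⟩ := hp
    obtain ⟨N', hN'⟩ := hq
    refine ⟨max N N', ?_⟩
    rw [map_add, map_add, ← hN, ← hN', ← Module.End.mul_apply, ← Module.End.mul_apply,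
      trunc_mul_trunc _ (le_max_left _ _), trunc_mul_trunc _ (le_max_right _ _)]
  | single i a => exact ⟨i + 1, by rw [coord_single, trunc_apply, if_pos i.lt_succ_self]⟩

/-- The filtration of `E ⊗ E` by the degree in `x` of the first factor. -/
noncomputable def filtration (N : ℕ) : Submodule k (TensorSquare k E) :=
  LinearMap.ker (TensorSquare.mapLeft (hE.trunc N) - LinearMap.id)

theorem mem_filtration {N : ℕ} {t : TensorSquare k E} :
    t ∈ hE.filtration N ↔ TensorSquare.mapLeft (hE.trunc N) t = t := by
  simp [filtration, sub_eq_zero]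

theorem mapLeft_trunc_mem (N : ℕ) (t : TensorSquare k E) :
    TensorSquare.mapLeft (hE.trunc N) t ∈ hE.filtration N := by
  rw [mem_filtration, TensorSquare.mapLeft_mapLeft, hE.trunc_mul_trunc le_rfl]

theorem filtration_mono : Monotone hE.filtration := fun N N' h t ht => by
  rw [mem_filtration] at *
  rw [← ht, TensorSquare.mapLeft_mapLeft, hE.trunc_mul_trunc h]

theorem exists_mem_filtration (t : TensorSquare k E) : ∃ N, t ∈ hE.filtration N := by
  induction t using TensorProduct.induction_on with
  | zero => exact ⟨0, zero_mem _⟩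
  | add s t hs ht =>
    obtain ⟨N, hN⟩ := hs
    obtain ⟨N', hN'⟩ := ht
    exact ⟨max N N', add_mem (hE.filtration_mono (le_max_left _ _) hN)
      (hE.filtration_mono (le_max_right _ _) hN')⟩
  | tmul m n =>
    obtain ⟨N, hN⟩ := hE.exists_trunc_eq m
    exact ⟨N, hE.mem_filtration.2 ((TensorSquare.mapLeft_tmul _ _ _).trans (by rw [hN]))⟩

theorem l_mem_filtration (N : ℕ) (a : A) (t : TensorSquare k E) (ht : t ∈ hE.filtration N) :
    (outerStr k E).toBi.l (ι a) t ∈ hE.filtration N := by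
  rw [mem_filtration] at *
  rw [TensorSquare.outer_l, TensorSquare.mapLeft_mapLeft, trunc_mulLeft,
    ← TensorSquare.mapLeft_mapLeft, ht]

theorem r_mem_filtration (N : ℕ) (e : E) (t : TensorSquare k E) (ht : t ∈ hE.filtration N) :
    (outerStr k E).toBi.r e t ∈ hE.filtration N := by
  rw [mem_filtration] at *
  rw [TensorSquare.outer_r_mapLeft, ht]

/-- Precomposing cochains with `σ` moves the twist from the right action to the left one, where
`lower (σ(a) t) = a lower t` absorbs it. So `lower` carries twisted coboundaries, restricted along
`σ`, to untwisted ones. -/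
theorem isHom_lower (N : ℕ) :
    (((outerStr k E).toBi.pull ι (ι.comp (σ.symm : A →ₐ[k] A))).pull (σ : A →ₐ[k] A)
      (σ : A →ₐ[k] A)).IsHom ((outerStr k E).toBi.pull ι ι)
      (TensorSquare.mapLeft (hE.lower N)) := by
  refine ⟨fun a t => ?_, fun a t => ?_⟩
  · simp only [pull_l, TensorSquare.outer_l]
    change TensorSquare.mapLeft (hE.lower N)
      (TensorSquare.mapLeft (LinearMap.mulLeft k (ι (σ a))) t) = _
    rw [TensorSquare.mapLeft_mapLeft, lower_mulLeft, ← TensorSquare.mapLeft_mapLeft]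
  · simpa using TensorSquare.outer_r_mapLeft (hE.lower N) (ι a) t

theorem lower_l_of_mem {N : ℕ} {t : TensorSquare k E} (ht : t ∈ hE.filtration (N + 1)) :
    TensorSquare.mapLeft (hE.lower N) ((outerStr k E).toBi.l x t) =
      TensorSquare.mapLeft (hE.top N) t := by
  rw [mem_filtration] at ht
  rw [← ht, TensorSquare.outer_l, TensorSquare.mapLeft_mapLeft, TensorSquare.mapLeft_mapLeft,
    TensorSquare.mapLeft_mapLeft, lower_mulLeft_trunc]

theorem lower_of_mem {N : ℕ} {t : TensorSquare k E} (ht : t ∈ hE.filtration (N + 1)) :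
    TensorSquare.mapLeft (hE.lower N) t = 0 := by
  rw [mem_filtration] at ht
  rw [← ht, TensorSquare.mapLeft_mapLeft, lower_trunc, map_zero, LinearMap.zero_apply]

theorem sub_top_mem {N : ℕ} {t : TensorSquare k E} (ht : t ∈ hE.filtration (N + 1)) :
    t - TensorSquare.mapLeft (hE.top N) t ∈ hE.filtration N := by
  have h := hE.mem_filtration.1 ht
  rw [← trunc_add_top, map_add, LinearMap.add_apply, ← eq_sub_iff_add_eq] at h
  rw [← h]
  exact hE.mapLeft_trunc_mem N t

/-- On cochains of degree at most `N`, the leading part of `θ` is invertible. -/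
theorem res_lower_theta {N n : ℕ} (f : Cochain k A (TensorSquare k E) n)
    (hf : ∀ a, f a ∈ hE.filtration (N + 1)) :
    post (TensorSquare.mapLeft (hE.lower N)) (res (σ : A →ₐ[k] A)
      (thetaE σ δ x (outerStr k E).toBi n f)) = post (TensorSquare.mapLeft (hE.top N)) f := by
  ext1 a
  simp only [post_apply, res_apply, thetaRec_apply, map_sub, map_sum, LinearMap.id_apply]
  rw [hE.lower_l_of_mem (hf _), TensorSquare.outer_r_mapLeft, hE.lower_of_mem (hf _),
    Finset.sum_eq_zero fun j _ => hE.lower_of_mem (hf _)]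
  simp

end IsOreExtension

variable {σ : A ≃ₐ[k] A} {δ : A →ₗ[k] A} {ι : A →ₐ[k] E} {x : E}
  (hE : IsOreExtension (σ : A →ₐ[k] A) δ ι x) (hδ : IsSkewDerivation (σ : A →ₐ[k] A) δ)
include hE hδ

theorem isCob_thetaE {M : Type v} [AddCommGroup M] [Module k M] (c : BiAction k E M) {n : ℕ}
    {f : Cochain k A M n} (hf : (c.pull ι ι).IsCob n f) :
    (c.pull ι (ι.comp (σ.symm : A →ₐ[k] A))).IsCob n (thetaE σ δ x c n f) := by
  cases n with
  | zero => exact (congrArg _ hf).trans (map_zero _)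
  | succ n =>
    obtain ⟨g, rfl⟩ := hf
    exact ⟨thetaE σ δ x c n g, (thetaE_D hE hδ c g).symm⟩

/-- `res_lower_theta` makes the top part of `f` a coboundary. Its image under `θ` is then one too,
so the hypothesis passes to the remainder, of smaller degree. The cochain `f` need not be assumed a
cocycle. -/
theorem isCob_of_mem_filtration {n : ℕ} (N : ℕ) (f : Cochain k A (TensorSquare k E) n)
    (hf : ∀ a, f a ∈ hE.filtration N)
    (hθ : ((outerStr k E).toBi.pull ι (ι.comp (σ.symm : A →ₐ[k] A))).IsCob n
      (thetaE σ δ x (outerStr k E).toBi n f)) : ((outerStr k E).toBi.pull ι ι).IsCob n f := by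
  induction N generalizing f with
  | zero =>
    have h0 : f = 0 := by
      ext1 a
      have := hE.mem_filtration.1 (hf a)
      rw [hE.trunc_zero, map_zero] at this
      exact this.symm
    subst h0
    cases n with
    | zero => rfl
    | succ n => exact ⟨0, map_zero _⟩
  | succ N ih =>
    have htop : ((outerStr k E).toBi.pull ι ι).IsCob n
        (post (TensorSquare.mapLeft (hE.top N)) f) := by
      rw [← hE.res_lower_theta f hf]
      have h := hθ.res (σ : A →ₐ[k] A)
      exact h.post (hE.isHom_lower N)
    refine IsCob.of_sub (ih _ (fun a => ?_) ?_) htop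
    · rw [sub_apply, post_apply]
      exact hE.sub_top_mem (hf a)
    have h := isCob_thetaE hE hδ (outerStr k E).toBi htop
    rw [map_sub]
    exact hθ.sub h

/-- The map induced by `θ` on the cohomology of `A` with values in `E ⊗ E` is injective. -/
theorem isCob_of_isCob_thetaE [Module.Projective k A] (hres : HasFGProjectiveResolution k A)
    {n : ℕ} {f : Cochain k A (TensorSquare k E) n}
    (hf : ((outerStr k E).toBi.pull ι ι).D n f = 0)
    (hθ : ((outerStr k E).toBi.pull ι (ι.comp (σ.symm : A →ₐ[k] A))).IsCob n
      (thetaE σ δ x (outerStr k E).toBi n f)) : ((outerStr k E).toBi.pull ι ι).IsCob n f := by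
  have hu : ((outerStr k E).toBi.pull ι ι).Unital :=
    ⟨fun t => by rw [pull_l, map_one, TensorSquare.outer_unital.1],
      fun t => by rw [pull_r, map_one, TensorSquare.outer_unital.2]⟩
  -- The replacement of `f` by a cohomologous `g` of bounded degree changes `θ f` only by a
  -- coboundary.
  obtain ⟨N, g, hg, -, hcob⟩ := exists_isCob_sub_of_directed hres hu hE.filtration
    hE.filtration_mono hE.l_mem_filtration (fun N a => hE.r_mem_filtration N (ι a))
    hE.exists_mem_filtration hf
  refine hcob.of_sub (isCob_of_mem_filtration hE hδ N g hg ?_)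
  have := hθ.sub (isCob_thetaE hE hδ _ hcob)
  rwa [map_sub, sub_sub_cancel] at this

end Filtration

end OreHochschild

/-! ### Translation to `HH` and linearity over the acting ring -/

namespace OreHochschild

open BiAction

section Bridge

variable {k : Type u} {A E : Type v} {R : Type w} {M : Type v} [CommRing k] [Ring A] [Algebra k A]
  [Ring E] [Algebra k E] [Ring R] [Algebra k R]
  [AddCommGroup M] [Module k M] [Module R M] [IsScalarTower k R M]

theorem mem_cocycles_iff {c : BimoduleStr k A R M} {n : ℕ} {f : Cochain k A M n} :
    f ∈ cocycles c n ↔ c.toBi.D n f = 0 := by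
  rw [cocycles, LinearMap.mem_ker, hochD_eq_D]

theorem mem_coboundaries_iff {c : BimoduleStr k A R M} {n : ℕ} {f : Cochain k A M n} :
    f ∈ coboundaries c n ↔ c.toBi.IsCob n f := by
  cases n with
  | zero => rfl
  | succ n => simp only [coboundaries, LinearMap.mem_range, hochD_eq_D, IsCob]

theorem HH.mk_eq_zero_iff {c : BimoduleStr k A R M} {n : ℕ} {f : cocycles c n} :
    HH.mk c n f = 0 ↔ c.toBi.IsCob n f.1 := by
  rw [← mem_coboundaries_iff]
  exact Submodule.Quotient.mk_eq_zero _

theorem BimoduleStr.toBi_restrict (c : BimoduleStr k E R M) (ι : A →ₐ[k] E) :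
    (c.restrict ι).toBi = c.toBi.pull ι ι := by
  have h1 : (c.restrict ι).toBi.l = (c.toBi.pull ι ι).l := by
    ext a m
    simp [BimoduleStr.lact, BimoduleStr.restrict]
  have h2 : (c.restrict ι).toBi.r = (c.toBi.pull ι ι).r := by
    ext a m
    simp [BimoduleStr.ract, BimoduleStr.restrict]
  revert h1 h2
  cases (c.restrict ι).toBi
  cases c.toBi.pull ι ι
  rintro ⟨⟩ ⟨⟩
  rfl

theorem BimoduleStr.toBi_twistRight (c : BimoduleStr k E R M) (ι : A →ₐ[k] E) (ν : A →ₐ[k] A) :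
    ((c.restrict ι).twistRight ν).toBi = c.toBi.pull ι (ι.comp ν) := by
  have h1 : ((c.restrict ι).twistRight ν).toBi.l = (c.toBi.pull ι (ι.comp ν)).l := by
    ext a m
    simp [BimoduleStr.lact, BimoduleStr.restrict, BimoduleStr.twistRight]
  have h2 : ((c.restrict ι).twistRight ν).toBi.r = (c.toBi.pull ι (ι.comp ν)).r := by
    ext a m
    simp [BimoduleStr.ract, BimoduleStr.restrict, BimoduleStr.twistRight]
  revert h1 h2
  cases ((c.restrict ι).twistRight ν).toBi
  cases c.toBi.pull ι (ι.comp ν)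
  rintro ⟨⟩ ⟨⟩
  rfl

theorem BimoduleStr.toBi_unital (c : BimoduleStr k E R M) : c.toBi.Unital :=
  ⟨fun m => DFunLike.congr_fun (map_one c) m, fun m => DFunLike.congr_fun (map_one c) m⟩

theorem theta_eq_thetaE (c : BimoduleStr k E R M) (σ : A ≃ₐ[k] A) (δ : A →ₗ[k] A) (x : E) {n : ℕ}
    (f : Cochain k A M n) : theta c σ δ x f = thetaE σ δ x c.toBi n f := by
  ext a
  rw [thetaE, thetaRec_apply]
  simp only [theta, sub_apply, sum_apply, MultilinearMap.compLinearMap_apply,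
    LinearMap.compMultilinearMap_apply]
  congr 1
  refine Finset.sum_congr rfl fun j _ => ?_
  refine congrArg f (funext fun i => ?_)
  split_ifs <;> rfl

/-- The action of a scalar as a `k`-linear map. -/
abbrev scalar (k : Type u) (M : Type v) [CommRing k] [Algebra k R] [AddCommGroup M] [Module k M]
    [Module R M] [IsScalarTower k R M] (r : R) : M →ₗ[k] M := Algebra.lsmul k k M r

theorem post_scalar (r : R) {n : ℕ} (f : Cochain k A M n) : post (scalar k M r) f = r • f := rfl

theorem isHom_scalar (c : BimoduleStr k A R M) (r : R) : c.toBi.IsHom c.toBi (scalar k M r) :=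
  ⟨fun a m => (map_smul (c.lact a) r m).symm, fun a m => (map_smul (c.ract a) r m).symm⟩

/-- The map `θ`, linear over the ring acting on the coefficients. -/
noncomputable def thetaLin (c : BimoduleStr k E R M) (σ : A ≃ₐ[k] A) (δ : A →ₗ[k] A) (x : E)
    (n : ℕ) : Cochain k A M n →ₗ[R] Cochain k A M n where
  toFun f := theta c σ δ x f
  map_add' f g := by simp only [theta_eq_thetaE, map_add]
  map_smul' r f := by
    simp only [theta_eq_thetaE, ← post_scalar, RingHom.id_apply]
    exact thetaE_post σ δ x (isHom_scalar c r) f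

end Bridge

/-- A total linear relation between modules which respects submodules induces a linear map between
the quotients. -/
theorem exists_quotientMap_of_relation {R X Y : Type*} [Ring R]
    [AddCommGroup X] [Module R X] [AddCommGroup Y] [Module R Y] (N : Submodule R X)
    (K : Submodule R Y) (S : Submodule R (X × Y)) (hS : ∀ y, ∃ x, (x, y) ∈ S)
    (hN : ∀ x y, (x, y) ∈ S → y ∈ K → x ∈ N) :
    ∃ g : (Y ⧸ K) →ₗ[R] (X ⧸ N), ∀ x y, (x, y) ∈ S → g (K.mkQ y) = N.mkQ x := by
  choose F hF using hS
  have key : ∀ x y, (x, y) ∈ S → N.mkQ (F y) = N.mkQ x := fun x y h =>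
    (Submodule.Quotient.eq N).2 (hN _ 0
      (by simpa only [Prod.mk_sub_mk, sub_self] using S.sub_mem (hF y) h) K.zero_mem)
  let G : Y →ₗ[R] X ⧸ N :=
    { toFun := fun y => N.mkQ (F y)
      map_add' := fun y z => (key _ _ (S.add_mem (hF y) (hF z))).trans (map_add _ _ _)
      map_smul' := fun r y => (key _ _ (S.smul_mem r (hF y))).trans (map_smul _ _ _) }
  exact ⟨K.liftQ G fun y hy => (Submodule.Quotient.mk_eq_zero N).2 (hN _ y (hF y) hy), key⟩

/-! ### The connecting homomorphism and exactness -/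

section Sequence

variable {k : Type u} {A E : Type v} {R : Type w} {M : Type v} [CommRing k] [Ring A] [Algebra k A]
  [Ring E] [Algebra k E] [Ring R] [Algebra k R]
  [AddCommGroup M] [Module k M] [Module R M] [IsScalarTower k R M]
  (σ : A ≃ₐ[k] A) (δ : A →ₗ[k] A) (ι : A →ₐ[k] E) (x : E)

theorem exists_coneD_eq_theta (c : BiAction k E M) {n : ℕ} (f : Cochain k A M n) :
    ∃ w, coneD σ δ ι x c n w = ((c.pull ι ι).D n f, thetaE σ δ x c n f) := by
  cases n with
  | zero => exact ⟨f, rfl⟩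
  | succ n => exact ⟨(f, 0), by rw [coneD_succ, map_zero, sub_zero]⟩

theorem exists_coneD_eq_of_isCob (c : BiAction k E M) {n : ℕ} {h : Cochain k A M n}
    (hh : (c.pull ι (ι.comp (σ.symm : A →ₐ[k] A))).IsCob n h) :
    ∃ w, coneD σ δ ι x c n w = (0, h) := by
  cases n with
  | zero => exact ⟨0, (map_zero _).trans (Prod.ext rfl hh.symm)⟩
  | succ n =>
    obtain ⟨h', rfl⟩ := hh
    exact ⟨(0, -h'), by rw [coneD_succ, map_zero, map_zero, map_neg, sub_neg_eq_add, zero_add]⟩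

/-- The first component of `w` is the cocycle sought; the second, when present, is a primitive of
the difference up to sign. -/
theorem exists_isCob_sub_theta (c : BiAction k E M) {n : ℕ} {h : Cochain k A M n}
    {w : Cone k A M n} (hw : coneD σ δ ι x c n w = (0, h)) :
    ∃ f, (c.pull ι ι).D n f = 0 ∧
      (c.pull ι (ι.comp (σ.symm : A →ₐ[k] A))).IsCob n (h - thetaE σ δ x c n f) := by
  cases n with
  | zero => exact ⟨w, congrArg Prod.fst hw, sub_eq_zero.2 (congrArg Prod.snd hw).symm⟩
  | succ n =>
    obtain ⟨f, h'⟩ := w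
    rw [coneD_succ] at hw
    have h2 : thetaE σ δ x c (n + 1) f -
      (c.pull ι (ι.comp (σ.symm : A →ₐ[k] A))).D n h' = h := congrArg Prod.snd hw
    refine ⟨f, congrArg Prod.fst hw, -h', ?_⟩
    rw [map_neg, ← h2]
    abel

/-- The pairs of a cocycle of the Ore extension and a cocycle of `A` which correspond to each
other under the connecting homomorphism. -/
def connecting (c : BimoduleStr k E R M) (n : ℕ) :
    Submodule R (cocycles c (n + 1) ×
      cocycles ((c.restrict ι).twistRight (σ.symm : A →ₐ[k] A)) n) where
  carrier := {p | ∃ w, coneD σ δ ι x c.toBi n w = (res ι p.1.1, eta σ ι x n p.1.1 - p.2.1)}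
  zero_mem' := ⟨0, by
    rw [map_zero]
    refine Prod.ext (map_zero _).symm ?_
    exact (sub_eq_zero.2 (map_zero (eta σ ι x n))).symm⟩
  add_mem' := by
    rintro p q ⟨w, hw⟩ ⟨w', hw'⟩
    refine ⟨w + w', ?_⟩
    rw [map_add, hw, hw']
    refine Prod.ext (map_add (res ι) _ _).symm ?_
    change _ = eta σ ι x n (p.1.1 + q.1.1) - (p.2.1 + q.2.1)
    rw [map_add, add_sub_add_comm]
    rfl
  smul_mem' := by
    rintro r p ⟨w, hw⟩
    refine ⟨conePost A (scalar k M r) n w, ?_⟩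
    rw [coneD_post σ δ ι x (isHom_scalar c r), hw]
    refine Prod.ext rfl ?_
    change post (scalar k M r) (eta σ ι x n p.1.1 - p.2.1) =
      eta σ ι x n (post (scalar k M r) p.1.1) - post (scalar k M r) p.2.1
    rw [map_sub, eta_post]

variable {σ δ ι x}

theorem mem_connecting {c : BimoduleStr k E R M} {n : ℕ} {F : cocycles c (n + 1)}
    {h : cocycles ((c.restrict ι).twistRight (σ.symm : A →ₐ[k] A)) n} :
    (F, h) ∈ connecting σ δ ι x c n ↔
      ∃ w, coneD σ δ ι x c.toBi n w = (res ι F.1, eta σ ι x n F.1 - h.1) := Iff.rfl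

/-- `(0, h)` is a cocycle of the cocone, so surjectivity of the comparison map gives `F`. The
relation compares in the opposite order, hence `-y`. -/
theorem exists_mem_connecting (hE : IsOreExtension (σ : A →ₐ[k] A) δ ι x)
    (hδ : IsSkewDerivation (σ : A →ₐ[k] A) δ) (c : BimoduleStr k E R M) (n : ℕ)
    (h : cocycles ((c.restrict ι).twistRight (σ.symm : A →ₐ[k] A)) n) :
    ∃ F, (F, h) ∈ connecting σ δ ι x c n := by
  have hh := h.2
  rw [mem_cocycles_iff, c.toBi_twistRight] at hh
  obtain ⟨F, hF, y, hy⟩ := (conePhi_quasiIso hE hδ (n + 1) c.toBi c.toBi_unital).1 (0, h.1)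
    (by rw [coneD_succ, hh, map_zero, map_zero, sub_zero]; rfl)
  refine ⟨⟨F, mem_cocycles_iff.2 hF⟩, mem_connecting.2 ⟨-y, ?_⟩⟩
  refine (map_neg _ y).trans ((congrArg Neg.neg hy).trans ((neg_sub _ _).trans ?_))
  exact Prod.ext (sub_zero _) rfl

theorem isCob_of_mem_connecting (hE : IsOreExtension (σ : A →ₐ[k] A) δ ι x)
    (hδ : IsSkewDerivation (σ : A →ₐ[k] A) δ) {c : BimoduleStr k E R M} {n : ℕ}
    {F : cocycles c (n + 1)} {h : cocycles ((c.restrict ι).twistRight (σ.symm : A →ₐ[k] A)) n}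
    (hs : (F, h) ∈ connecting σ δ ι x c n) (hh : HH.mk _ n h = 0) : HH.mk c (n + 1) F = 0 := by
  obtain ⟨w, hw⟩ := mem_connecting.1 hs
  rw [HH.mk_eq_zero_iff, c.toBi_twistRight] at hh
  obtain ⟨w', hw'⟩ := exists_coneD_eq_of_isCob σ δ ι x c.toBi hh
  refine HH.mk_eq_zero_iff.2 ((conePhi_quasiIso hE hδ (n + 1) c.toBi c.toBi_unital).2 F.1
    (mem_cocycles_iff.1 F.2) ⟨w + w', ?_⟩)
  rw [map_add, hw, hw', conePhi_succ]
  exact Prod.ext (add_zero _) (sub_add_cancel _ _)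

/-- The connecting homomorphism. -/
theorem exists_connectingHom (hE : IsOreExtension (σ : A →ₐ[k] A) δ ι x)
    (hδ : IsSkewDerivation (σ : A →ₐ[k] A) δ) (c : BimoduleStr k E R M) (n : ℕ) :
    ∃ g : HH ((c.restrict ι).twistRight (σ.symm : A →ₐ[k] A)) n →ₗ[R] HH c (n + 1),
      ∀ (F : cocycles c (n + 1)) (h : cocycles ((c.restrict ι).twistRight (σ.symm : A →ₐ[k] A)) n),
        (F, h) ∈ connecting σ δ ι x c n → g (HH.mk _ n h) = HH.mk c (n + 1) F := by
  exact exists_quotientMap_of_relation _ _ (connecting σ δ ι x c n)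
    (exists_mem_connecting hE hδ c n) fun F h hs hh =>
      (Submodule.Quotient.mk_eq_zero _).1 (isCob_of_mem_connecting hE hδ hs
        ((Submodule.Quotient.mk_eq_zero _).2 hh))

theorem theta_mem_cocycles (hE : IsOreExtension (σ : A →ₐ[k] A) δ ι x)
    (hδ : IsSkewDerivation (σ : A →ₐ[k] A) δ) (c : BimoduleStr k E R M) {n : ℕ}
    (f : Cochain k A M n) (hf : f ∈ cocycles (c.restrict ι) n) :
    theta c σ δ x f ∈ cocycles ((c.restrict ι).twistRight (σ.symm : A →ₐ[k] A)) n := by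
  rw [mem_cocycles_iff, c.toBi_restrict] at hf
  rw [mem_cocycles_iff, c.toBi_twistRight, theta_eq_thetaE, ← thetaE_D hE hδ, hf, map_zero]

/-- The map induced by `θ` in cohomology. -/
noncomputable def thetaHH (hE : IsOreExtension (σ : A →ₐ[k] A) δ ι x)
    (hδ : IsSkewDerivation (σ : A →ₐ[k] A) δ) (c : BimoduleStr k E R M) (n : ℕ) :
    HH (c.restrict ι) n →ₗ[R] HH ((c.restrict ι).twistRight (σ.symm : A →ₐ[k] A)) n :=
  Submodule.mapQ _ _ ((thetaLin c σ δ x n).restrict (theta_mem_cocycles hE hδ c)) (by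
    intro f hf
    change theta c σ δ x f.1 ∈ coboundaries _ n
    rw [mem_coboundaries_iff, c.toBi_twistRight, theta_eq_thetaE]
    refine isCob_thetaE hE hδ _ ?_
    rw [← c.toBi_restrict, ← mem_coboundaries_iff]
    exact hf)

theorem thetaHH_mk (hE : IsOreExtension (σ : A →ₐ[k] A) δ ι x)
    (hδ : IsSkewDerivation (σ : A →ₐ[k] A) δ) (c : BimoduleStr k E R M) (n : ℕ)
    (f : cocycles (c.restrict ι) n) : thetaHH hE hδ c n (HH.mk _ n f) =
      HH.mk _ n ⟨theta c σ δ x f.1, theta_mem_cocycles hE hδ c f.1 f.2⟩ := rfl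

theorem thetaHH_injective (hE : IsOreExtension (σ : A →ₐ[k] A) δ ι x)
    (hδ : IsSkewDerivation (σ : A →ₐ[k] A) δ) (c : BimoduleStr k E R M) (n : ℕ)
    (hinj : ∀ (f : Cochain k A M n), (c.toBi.pull ι ι).D n f = 0 →
      (c.toBi.pull ι (ι.comp (σ.symm : A →ₐ[k] A))).IsCob n (thetaE σ δ x c.toBi n f) →
      (c.toBi.pull ι ι).IsCob n f) : Function.Injective (thetaHH hE hδ c n) := by
  refine (injective_iff_map_eq_zero _).2 fun y hy => ?_
  obtain ⟨f, rfl⟩ := Submodule.mkQ_surjective _ y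
  have hf := f.2
  rw [mem_cocycles_iff, c.toBi_restrict] at hf
  replace hy := (thetaHH_mk hE hδ c n f).symm.trans hy
  rw [HH.mk_eq_zero_iff, c.toBi_twistRight] at hy
  change IsCob _ n (theta c σ δ x f.1) at hy
  rw [theta_eq_thetaE] at hy
  refine HH.mk_eq_zero_iff.2 ?_
  rw [c.toBi_restrict]
  exact hinj f.1 hf hy

/-- If `F = D G`, subtracting `w` from the image of `G` gives a primitive of `(0, h)` in the cocone,
whose first component is the preimage. Conversely, `(0, θ f)` bounds in the cocone for a cocycle
`f`, so it corresponds to the zero class. -/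
theorem exact_thetaHH (hE : IsOreExtension (σ : A →ₐ[k] A) δ ι x)
    (hδ : IsSkewDerivation (σ : A →ₐ[k] A) δ) (c : BimoduleStr k E R M) (n : ℕ)
    (g : HH ((c.restrict ι).twistRight (σ.symm : A →ₐ[k] A)) n →ₗ[R] HH c (n + 1))
    (hg : ∀ (F : cocycles c (n + 1))
      (h : cocycles ((c.restrict ι).twistRight (σ.symm : A →ₐ[k] A)) n),
      (F, h) ∈ connecting σ δ ι x c n → g (HH.mk _ n h) = HH.mk c (n + 1) F) :
    Function.Exact (thetaHH hE hδ c n) g := by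
  intro y
  constructor
  · intro hy
    obtain ⟨h, rfl⟩ := Submodule.mkQ_surjective _ y
    obtain ⟨F, hF⟩ := exists_mem_connecting hE hδ c n h
    obtain ⟨w, hw⟩ := mem_connecting.1 hF
    obtain ⟨G, hG⟩ := HH.mk_eq_zero_iff.1 ((hg F h hF).symm.trans hy)
    obtain ⟨f, hf, hcob⟩ := exists_isCob_sub_theta σ δ ι x c.toBi
      (w := conePhi σ ι x n G - w) (h := h.1) (by
        rw [map_sub, ← conePhi_D hE, hw, hG, conePhi_succ]
        exact Prod.ext (sub_self _) (sub_sub_cancel _ _))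
    rw [← c.toBi_restrict, ← mem_cocycles_iff] at hf
    refine ⟨HH.mk _ n ⟨f, hf⟩, ?_⟩
    rw [thetaHH_mk]
    refine (sub_eq_zero.1 ?_).symm
    refine (map_sub (HH.mk _ n) h _).symm.trans (HH.mk_eq_zero_iff.2 ?_)
    change IsCob _ n (h.1 - theta c σ δ x f)
    rw [theta_eq_thetaE, c.toBi_twistRight]
    exact hcob
  · rintro ⟨y, rfl⟩
    obtain ⟨f, rfl⟩ := Submodule.mkQ_surjective _ y
    have hf := f.2
    rw [mem_cocycles_iff, c.toBi_restrict] at hf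
    obtain ⟨w, hw⟩ := exists_coneD_eq_theta σ δ ι x c.toBi f.1
    refine (hg 0 _ (mem_connecting.2 ⟨-w, ?_⟩)).trans (map_zero _)
    rw [map_neg, hw, hf]
    refine Prod.ext (neg_zero.trans (map_zero (res ι)).symm) ?_
    change -thetaE σ δ x c.toBi n f.1 = eta σ ι x n 0 - theta c σ δ x f.1
    rw [map_zero, zero_sub, theta_eq_thetaE]

/-- By the null homotopy, `θ` of the restriction of a cocycle `F` is a coboundary. Injectivity in
degree `n + 1` gives `res F = D f`, and correcting `eta F` by `θ f` yields a cocycle mapping to the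
class of `F`. -/
theorem connectingHom_surjective (hE : IsOreExtension (σ : A →ₐ[k] A) δ ι x)
    (hδ : IsSkewDerivation (σ : A →ₐ[k] A) δ) (c : BimoduleStr k E R M) (n : ℕ)
    (hinj : ∀ (f : Cochain k A M (n + 1)), (c.toBi.pull ι ι).D (n + 1) f = 0 →
      (c.toBi.pull ι (ι.comp (σ.symm : A →ₐ[k] A))).IsCob (n + 1)
        (thetaE σ δ x c.toBi (n + 1) f) → (c.toBi.pull ι ι).IsCob (n + 1) f)
    (g : HH ((c.restrict ι).twistRight (σ.symm : A →ₐ[k] A)) n →ₗ[R] HH c (n + 1))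
    (hg : ∀ (F : cocycles c (n + 1))
      (h : cocycles ((c.restrict ι).twistRight (σ.symm : A →ₐ[k] A)) n),
      (F, h) ∈ connecting σ δ ι x c n → g (HH.mk _ n h) = HH.mk c (n + 1) F) :
    Function.Surjective g := by
  intro y
  obtain ⟨F, rfl⟩ := Submodule.mkQ_surjective _ y
  have hF := mem_cocycles_iff.1 F.2
  have hcob := thetaRec_res (δ := δ) hE.comm (n + 1) c.toBi F.1
  rw [hF, map_zero, zero_add, etaBd] at hcob
  obtain ⟨f, hf⟩ := hinj (res ι F.1) (by rw [D_res, hF, map_zero]) ⟨_, hcob.symm⟩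
  have hh : eta σ ι x n F.1 - thetaE σ δ x c.toBi n f ∈
      cocycles ((c.restrict ι).twistRight (σ.symm : A →ₐ[k] A)) n := by
    rw [mem_cocycles_iff, c.toBi_twistRight, map_sub, ← thetaE_D hE hδ, hf, ← hcob]
    exact sub_self _
  obtain ⟨w, hw⟩ := exists_coneD_eq_theta σ δ ι x c.toBi f
  refine ⟨HH.mk _ n ⟨_, hh⟩, hg F _ (mem_connecting.2 ⟨w, ?_⟩)⟩
  rw [hw, hf]
  exact Prod.ext rfl (sub_sub_cancel _ _).symm

end Sequence

end OreHochschild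

theorem mainTheorem2 {k : Type u} {A E : Type v} [CommRing k] [Ring A] [Algebra k A]
    [Ring E] [Algebra k E]
    (hproj : Module.Projective k A)
    (hres : OreHochschild.HasFGProjectiveResolution k A)
    (σ : A ≃ₐ[k] A) (δ : A →ₗ[k] A)
    (hδ : OreHochschild.IsSkewDerivation (σ : A →ₐ[k] A) δ)
    (ι : A →ₐ[k] E) (x : E)
    (hE : OreHochschild.IsOreExtension (σ : A →ₐ[k] A) δ ι x) (n : ℕ) :
    let c : OreHochschild.BimoduleStr k E (OreHochschild.Env k E)
      (OreHochschild.TensorSquare k E) := OreHochschild.outerStr k E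
    let cA := c.restrict ι
    let cAσ := cA.twistRight (σ.symm : A →ₐ[k] A)
    ∃ (d : OreHochschild.HH cA n →ₗ[OreHochschild.Env k E] OreHochschild.HH cAσ n)
      (g : OreHochschild.HH cAσ n →ₗ[OreHochschild.Env k E] OreHochschild.HH c (n + 1)),
      (∀ f : OreHochschild.cocycles cA n,
        ∃ h : OreHochschild.theta c σ δ x f.1 ∈ OreHochschild.cocycles cAσ n,
          d (OreHochschild.HH.mk cA n f) =
            OreHochschild.HH.mk cAσ n ⟨OreHochschild.theta c σ δ x f.1, h⟩) ∧
      Function.Injective d ∧ Function.Exact d g ∧ Function.Surjective g := by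
  intro c cA cAσ
  -- Stated for all degrees because degree `n` gives injectivity of `d` and degree `n + 1` gives
  -- surjectivity of `g`.
  have hinj : ∀ (m : ℕ) (f : OreHochschild.Cochain k A (OreHochschild.TensorSquare k E) m), _ → _ →
    _ := fun m f hf hθ => OreHochschild.isCob_of_isCob_thetaE hE hδ hres (n := m) (f := f) hf hθ
  obtain ⟨g, hg⟩ := OreHochschild.exists_connectingHom hE hδ c n
  exact ⟨OreHochschild.thetaHH hE hδ c n, g,
    fun f => ⟨OreHochschild.theta_mem_cocycles hE hδ c f.1 f.2,
      OreHochschild.thetaHH_mk hE hδ c n f⟩,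
    OreHochschild.thetaHH_injective hE hδ c n (hinj n), OreHochschild.exact_thetaHH hE hδ c n g hg,
    OreHochschild.connectingHom_surjective hE hδ c n (hinj (n + 1)) g hg⟩
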